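/- Notation. All graphs are finite and simple, $L(G)=D-A$ is the Laplacian of a graph $G$, $\sigma(\cdot)$ denotes the spectrum, $\lambda_{\min}(M)$ is the smallest eigenvalue of a symmetric matrix $M$, $a(G)$ is the smallest nonzero eigenvalue of $L(G)$ for a connected graph $G$ with at least two vertices, and a Fiedler vector of $G$ is an eigenvector of $L(G)$ for $a(G)$. A vertex of degree one is called pendant. For vertices $v\ne w$ of $G$, $L_v(G)$ and $L_{v,w}(G)$ are obtained from $L(G)$ by deleting the row and column of $v$, respectively the rows and columns of $v$ and $w$. Let $S$ be a tree and $v_0$ a pendant vertex of $S$. An $S$-caterpillar $T$ is a tree obtained from a path $v_1\ldots v_k$, $k\ge 1$ (the central path), by attaching to each $v_i$ a number $m_i\ge 0$ of disjoint copies of $S$, where in each copy the vertex $v_0$ is identified with $v_i$; here $m_1\ge 1$ and $m_k\ge 1$. For a vertex $v$ of $S$ let $d=d(v_0,v)$, let $w_1=v_0,w_2,\ldots,w_{d+1}=v$ be the path from $v_0$ to $v$ in $S$, let $S_{i}$ be the tree associated with $w_{i}$, that is, the maximal subtree of $S$ that meets this path only in $w_{i}$, and put $$\varphi(v)=-d(v_0,v)-\sum_{i=1}^{d(v_0,v)-1}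 i\,|V(S_{i+1})| .$$ Corollary 5.4. Let $T$ be an $S$-caterpillar with central path $v_1\ldots v_k$ and assume that $a(T)<\lambda_{\min}(L_{v_0}(S))$. Then $a(T)$ is a simple eigenvalue of $L(T)$, so there exists a Fiedler vector of $T$ and it is unique up to scaling, and the following holds. (a) One of the two extremal entries (maximum and minimum) of the Fiedler vector is attained only at vertices which are copies of pendant vertices of $S$ other than $v_0$ in the copies of $S$ attached to $v_1$, and the other one only at such vertices in the copies attached to $v_k$. (b) If $v$ is a pendant vertex of $S$ with $d(v_0,v)\ge 2$, then $\varphi(v)=g_{v,v_0}'(0)$ for $$g_{v,v_0}(\lambda)=\frac{1-\lambda-e_v^\top(L_{v,v_0}(S)-\lambda)^{-1}e_v}{e_{v_0}^\top(L_{v,v_0}(S)-\lambda)^{-1}e_v},$$ where $e_v$ and $e_{v_0}$ are the canonical unit vectors belonging to the neighbour of $v$ and to the neighbour of $v_0$. Assume that there is a unique vertex $v$ of $S$ that minimizes $\varphi$. Then there is a number $K$ that depends only on $S$ and $v_0$ such that, if $k\ge K$, one of the two extremal entries of the Fiedler vector of $T$ is attained exactly at the copies of $v$ in the copies of $S$ attached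 to $v_1$, and the other one exactly at the copies of $v$ in the copies of $S$ attached to $v_k$. -/

import Mathlib

open scoped Matrix

namespace SCaterpillar

section Spectral

variable {V : Type*} [Fintype V] [DecidableEq V]

/-- The smallest element of the spectrum of a symmetric real matrix. -/
noncomputable def lambdaMin (M : Matrix V V ℝ) : ℝ :=
  sInf (spectrum ℝ M)

/-- The algebraic connectivity `a(G)` of a connected graph: the smallest nonzero eigenvalue of the
graph Laplacian. -/
noncomputable def algebraicConnectivity (G : SimpleGraph V) [DecidableRel G.Adj] : ℝ :=
  sInf (spectrum ℝ (G.lapMatrix ℝ) \ {0})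

/-- A Fiedler vector: an eigenvector of the graph Laplacian for the eigenvalue `a(G)`. -/
def IsFiedlerVector (G : SimpleGraph V) [DecidableRel G.Adj] (x : V → ℝ) : Prop :=
  Module.End.HasEigenvector (Matrix.toLin' (G.lapMatrix ℝ)) (algebraicConnectivity G) x

/-- The reduced Laplacian `L_v(G)`: row and column `v` of the Laplacian are deleted. -/
def reducedLaplacian (G : SimpleGraph V) [DecidableRel G.Adj] (v : V) :
    Matrix {u : V // u ≠ v} {u : V // u ≠ v} ℝ :=
  (G.lapMatrix ℝ).submatrix Subtype.val Subtype.val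

/-- The doubly reduced Laplacian `L_{v,w}(G)`: rows and columns `v` and `w` are deleted. -/
def doublyReducedLaplacian (G : SimpleGraph V) [DecidableRel G.Adj] (v w : V) :
    Matrix {u : V // u ≠ v ∧ u ≠ w} {u : V // u ≠ v ∧ u ≠ w} ℝ :=
  (G.lapMatrix ℝ).submatrix Subtype.val Subtype.val

/-- The indicator vector of the neighbours of `z`, among the vertices different from `v`, `w`.
For a pendant vertex `z` whose neighbour is neither `v` nor `w` it is a canonical unit vector. -/
def nbrVec (G : SimpleGraph V) [DecidableRel G.Adj] (v w z : V) :
    {u : V // u ≠ v ∧ u ≠ w} → ℝ :=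
  fun u => if G.Adj z u.1 then 1 else 0

/-- The function `g_{v,w}` for two nonadjacent pendant vertices `v`, `w` of a tree `G`:
`(1 - t - e_vᵀ (L_{v,w}(G) - t)⁻¹ e_v) / (e_wᵀ (L_{v,w}(G) - t)⁻¹ e_v)`, where `e_v` and `e_w`
are the unit vectors belonging to the neighbours of `v` and of `w`. -/
noncomputable def g (G : SimpleGraph V) [DecidableRel G.Adj] (v w : V) (t : ℝ) : ℝ :=
  (1 - t - nbrVec G v w v ⬝ᵥ
      ((doublyReducedLaplacian G v w - t • (1 : Matrix _ _ ℝ))⁻¹ *ᵥ nbrVec G v w v)) /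
    (nbrVec G v w w ⬝ᵥ
      ((doublyReducedLaplacian G v w - t • (1 : Matrix _ _ ℝ))⁻¹ *ᵥ nbrVec G v w v))

end Spectral

section Branches

variable {V : Type*}

/-- The unique path from `u` to `v` in a tree. -/
noncomputable def treePath {S : SimpleGraph V} (hS : S.IsTree) (u v : V) : S.Walk u v :=
  (hS.existsUnique_path u v).choose

/-- The vertex set of the tree associated with the `i`-th vertex `p.getVert i` of the path `p`
(counted from `0`): all vertices joined to it by a walk that meets `p` in no other vertex. -/
def associatedTree {S : SimpleGraph V} {u v : V} (p : S.Walk u v) (i : ℕ) : Set V :=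
  {y | ∃ q : S.Walk y (p.getVert i), ∀ z ∈ q.support, z ∈ p.support → z = p.getVert i}

/-- The quantity `-d(v₀,v) - ∑_{i=1}^{d(v₀,v)-1} i |V(S_{i+1})|`, where `S_{i+1}` is the tree
associated with the vertex at distance `i` from `v₀` on the path from `v₀` to `v`.
For `v = v₀` the sum is empty and the value is `0`. -/
noncomputable def slope {S : SimpleGraph V} (hS : S.IsTree) (v₀ v : V) : ℝ :=
  -(S.dist v₀ v : ℝ) - ∑ i ∈ Finset.Icc 1 (S.dist v₀ v - 1),
    (i : ℝ) * ((associatedTree (treePath hS v₀ v) i).ncard : ℝ)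

end Branches

section Caterpillar

variable {V : Type*}

/-- Vertices of an `S`-caterpillar with central path of `n + 1` vertices and `m i` copies of `S`
attached at the `i`-th of them: `Sum.inl i` is a vertex of the central path, and
`Sum.inr ⟨i, j, u⟩` is the vertex `u ≠ v₀` in the `j`-th copy of `S` at the `i`-th path vertex. -/
abbrev Vert (v₀ : V) (n : ℕ) (m : Fin (n + 1) → ℕ) : Type _ :=
  Fin (n + 1) ⊕ (Σ i : Fin (n + 1), Fin (m i) × {u : V // u ≠ v₀})

/-- The `S`-caterpillar: in every copy of `S` at the `i`-th vertex of the central path, the vertex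
`v₀` of `S` is identified with that path vertex. -/
def caterpillar (S : SimpleGraph V) (v₀ : V) (n : ℕ) (m : Fin (n + 1) → ℕ) :
    SimpleGraph (Vert v₀ n m) where
  Adj p q :=
    match p, q with
    | Sum.inl i, Sum.inl i' => (SimpleGraph.pathGraph (n + 1)).Adj i i'
    | Sum.inl i, Sum.inr b => i = b.1 ∧ S.Adj v₀ b.2.2.1
    | Sum.inr b, Sum.inl i => i = b.1 ∧ S.Adj v₀ b.2.2.1
    | Sum.inr b, Sum.inr c =>
        b.1 = c.1 ∧ (b.2.1 : ℕ) = (c.2.1 : ℕ) ∧ S.Adj b.2.2.1 c.2.2.1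
  symm := ⟨by
    rintro (i | b) (i' | c) h
    · exact SimpleGraph.Adj.symm h
    · exact h
    · exact h
    · exact ⟨h.1.symm, h.2.1.symm, h.2.2.symm⟩⟩
  loopless := ⟨by
    rintro (i | b) h
    · exact SimpleGraph.irrefl _ h
    · exact SimpleGraph.irrefl _ h.2.2⟩

noncomputable instance (S : SimpleGraph V) (v₀ : V) (n : ℕ) (m : Fin (n + 1) → ℕ) :
    DecidableRel (caterpillar S v₀ n m).Adj :=
  Classical.decRel _

/-- `p` is a vertex in one of the copies of `S` attached to the `i`-th vertex of the central path,
and it is a copy of a vertex of `S` that satisfies `P`. -/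
def InCopyAt {v₀ : V} {n : ℕ} {m : Fin (n + 1) → ℕ} (i : Fin (n + 1)) (P : V → Prop)
    (p : Vert v₀ n m) : Prop :=
  ∃ (j : Fin (m i)) (u : {u : V // u ≠ v₀}), P u.1 ∧ p = Sum.inr ⟨i, j, u⟩

end Caterpillar

/-- The largest entry of `x` is located at `p`. -/
def MaxAt {W : Type*} (x : W → ℝ) (p : W) : Prop := ∀ q, x q ≤ x p

/-- The smallest entry of `x` is located at `p`. -/
def MinAt {W : Type*} (x : W → ℝ) (p : W) : Prop := ∀ q, x p ≤ x q

end SCaterpillar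

/-!
# Fiedler vectors of caterpillars built from copies of a tree

Let `μ = a(T)`. Since `μ < λ_min(L_{v₀}(S))`, the equation `L h = μ h` off `v₀` has exactly one
solution `h` on `S` with `h(v₀) = 1` (`exists_isProfile`), and every solution is a multiple of it.
So a Fiedler vector of `T` equals `z_i h` on each copy of `S` at the `i`-th vertex of the central
path, where `z` are its values on that path, and `z` solves a weighted eigenvalue equation `L_P z
= ρ z` on the path `P`, with weights `ρ_i ≥ μ` (`exists_isPathEigen`). As `z` is determined by its
first entry, the eigenvalue is simple.

On the tree side, the Gromov product `(u | w)` based at `v₀` is the Green function of the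
Laplacian that vanishes at the root, so that `h(u) = 1 + μ ∑_w (u | w) h(w)`
(`green_representation`). The negative part of `h` vanishes by an energy estimate; hence `h ≥ 1`, and `h`
increases strictly along every edge leading away from `v₀`. Its maxima are pendant vertices other than `v₀`
(`degree_eq_one_of_isMax`).

On the path side, `a(T)` minimizes the Rayleigh quotient over the vectors with entry sum zero, and
this property passes to the path (`isPathEigen_of_energy_nonpos`). It implies that `z` changes its
sign only once (`IsPathEigen.exists_sign_change`), so that all partial sums of `ρ z`, which are
the differences `z_i - z_{i+1}`, have the same sign. Thus `z` is strictly monotone with end values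
of opposite signs, and the extremal entries of the Fiedler vector lie at the maxima of `h` in the
copies at the two ends (`extremal_fiedler`). The same flux identity gives `μ (k - 2) ≤ 2` for a
central path with `k` vertices, whatever the numbers of attached copies are
(`IsPathEigen.mul_le_two`).

For part (b), let `H(u) = ∑_w (u | w)`. Grouping the vertices `w` by the value of `(u | w)` shows
that `-φ(u) ≤ H(u)`, with equality at pendant vertices, so a unique minimizer `v` of `φ` is the
unique maximizer of `H` (`totalGromov_lt_of_slope_lt`). Since `h = 1 + μ H + O(μ²)` with a
constant that depends only on `S`, and `H` is integer-valued, `v` is the unique maximizer of `h`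
once `μ` is small, that is, once `k` is large. Finally `g_{v,v₀}'(0) = -H(v)`, by the resolvent
identity and Green's identity for `H` and the harmonic function with boundary values `1` at `v`
and `0` at `v₀` (`hasDerivAt_g`).
-/

namespace SCaterpillar

/-! ### The Laplacian of a graph -/

section Laplacian

variable {V : Type*} [Fintype V] [DecidableEq V] (G : SimpleGraph V) [DecidableRel G.Adj]

lemma lapMatrix_mulVec_eq_sum (x : V → ℝ) (p : V) :
    (G.lapMatrix ℝ *ᵥ x) p = ∑ q, if G.Adj p q then x p - x q else 0 := by
  rw [SimpleGraph.lapMatrix_mulVec_apply, SimpleGraph.degree_eq_sum_if_adj, Finset.sum_mul,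
    ← SimpleGraph.adjMatrix_mulVec_apply (α := ℝ), Matrix.mulVec, dotProduct,
    ← Finset.sum_sub_distrib]
  refine Finset.sum_congr rfl fun q _ => ?_
  by_cases h : G.Adj p q <;> simp [SimpleGraph.adjMatrix_apply, h]

lemma lapMatrix_dotProduct_comm (x y : V → ℝ) :
    x ⬝ᵥ (G.lapMatrix ℝ *ᵥ y) = y ⬝ᵥ (G.lapMatrix ℝ *ᵥ x) := by
  rw [Matrix.dotProduct_mulVec, ← Matrix.mulVec_transpose, SimpleGraph.isSymm_lapMatrix,
    dotProduct_comm]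

lemma sum_lapMatrix_mulVec (x : V → ℝ) : ∑ p, (G.lapMatrix ℝ *ᵥ x) p = 0 := by
  have h := lapMatrix_dotProduct_comm G (fun _ => 1) x
  rw [SimpleGraph.lapMatrix_mulVec_const_eq_zero, dotProduct_zero] at h
  simpa [dotProduct] using h

variable {G}

/-- On a connected graph, harmonic functions are constant. -/
lemma eq_of_lapMatrix_mulVec_eq_zero (hG : G.Connected) {x : V → ℝ}
    (hx : G.lapMatrix ℝ *ᵥ x = 0) (p q : V) : x p = x q :=
  (SimpleGraph.lapMatrix_mulVec_eq_zero_iff_forall_reachable G).1 hx p q (hG p q)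

end Laplacian

/-! ### The Gromov product of a tree as a Green function -/

section Tree

variable {V : Type*}

/-- The Gromov product of `u` and `w` with respect to the root `r`. In a tree it is the number of
edges that the paths from `r` to `u` and from `r` to `w` have in common. -/
noncomputable def gromov (S : SimpleGraph V) (r u w : V) : ℝ :=
  ((S.dist r u : ℝ) + S.dist r w - S.dist u w) / 2

variable {S : SimpleGraph V}

lemma gromov_comm (r u w : V) : gromov S r u w = gromov S r w u := by
  simp only [gromov, S.dist_comm (u := u) (v := w)]
  ring

lemma gromov_root (r w : V) : gromov S r r w = 0 := by
  simp [gromov]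

lemma gromov_self (r u : V) : gromov S r u u = S.dist r u := by
  simp [gromov]

lemma gromov_nonneg (hS : S.Connected) (r u w : V) : 0 ≤ gromov S r u w := by
  have h : S.dist u w ≤ S.dist u r + S.dist r w := hS.dist_triangle
  rw [S.dist_comm (u := u) (v := r)] at h
  have : (S.dist u w : ℝ) ≤ S.dist r u + S.dist r w := by exact_mod_cast h
  unfold gromov
  linarith

/-- In a tree every vertex `u ≠ w` has exactly one neighbour that is closer to `w`. -/
lemma exists_closer_neighbor (hS : S.IsTree) {w u : V} (h : u ≠ w) :
    ∃ a, S.Adj u a ∧ S.dist w u = S.dist w a + 1 ∧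
      ∀ b, S.Adj u b → b ≠ a → S.dist w b = S.dist w u + 1 := by
  obtain ⟨p, hp, hlen⟩ := hS.connected.exists_path_of_dist u w
  cases p with
  | nil => exact absurd rfl h
  | @cons _ a _ hua q =>
    have hq : S.dist a w ≤ q.length := S.dist_le q
    have hd : S.dist w u = S.dist w a + 1 := by
      rcases hS.dist_eq_dist_add_one_of_adj w hua with h1 | h1
      · exact h1
      · rw [SimpleGraph.Walk.length_cons, S.dist_comm] at hlen
        rw [S.dist_comm (u := a)] at hq
        omega
    refine ⟨a, hua, hd, fun b hub hba => ?_⟩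
    rcases hS.dist_eq_dist_add_one_of_adj w hub with h1 | h1
    · exfalso
      obtain ⟨q', hq', hlen'⟩ := hS.connected.exists_path_of_dist b w
      have hpath : (SimpleGraph.Walk.cons hub q').IsPath := by
        apply SimpleGraph.Walk.isPath_of_length_eq_dist
        rw [SimpleGraph.Walk.length_cons, hlen', S.dist_comm (u := b), S.dist_comm (u := u)]
        exact h1.symm
      have heq := (hS.existsUnique_path u w).unique hp hpath
      simp only [SimpleGraph.Walk.cons.injEq] at heq
      exact hba heq.1.symm
    · exact h1

variable [Fintype V] [DecidableEq V] [DecidableRel S.Adj]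

lemma lapMatrix_mulVec_dist (hS : S.IsTree) {w u : V} (h : u ≠ w) :
    (S.lapMatrix ℝ *ᵥ fun y => (S.dist w y : ℝ)) u = 2 - S.degree u := by
  obtain ⟨a, hua, hd, hb⟩ := exists_closer_neighbor hS h
  rw [lapMatrix_mulVec_eq_sum, SimpleGraph.degree_eq_sum_if_adj]
  have : ∀ q, (if S.Adj u q then (S.dist w u : ℝ) - S.dist w q else 0) =
      (if q = a then 2 else 0) - if S.Adj u q then 1 else 0 := by
    intro q
    by_cases hq : S.Adj u q
    · by_cases hqa : q = a
      · subst hqa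
        simp only [hq, if_true, hd]
        push_cast; ring
      · simp only [hq, hqa, if_true, if_false, hb q hq hqa]
        push_cast; ring
    · have : q ≠ a := by rintro rfl; exact hq hua
      simp [hq, this]
  simp_rw [this]
  rw [Finset.sum_sub_distrib]
  simp

lemma lapMatrix_mulVec_dist_self (w : V) :
    (S.lapMatrix ℝ *ᵥ fun y => (S.dist w y : ℝ)) w = - S.degree w := by
  rw [lapMatrix_mulVec_eq_sum, SimpleGraph.degree_eq_sum_if_adj, ← Finset.sum_neg_distrib]
  refine Finset.sum_congr rfl fun q _ => ?_
  by_cases hq : S.Adj w q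
  · simp [hq, SimpleGraph.dist_eq_one_iff_adj.2 hq]
  · simp [hq]

/-- The Gromov product inverts the Laplacian off the root. -/
lemma lapMatrix_mulVec_gromov (hS : S.IsTree) {r u : V} (w : V) (h : u ≠ r) :
    (S.lapMatrix ℝ *ᵥ gromov S r w) u = if u = w then 1 else 0 := by
  have key : gromov S r w = (1 / 2 : ℝ) • ((fun y => (S.dist r y : ℝ)) +
      (S.dist r w : ℝ) • (fun _ => (1 : ℝ)) - fun y => (S.dist w y : ℝ)) := by
    funext y
    simp only [gromov, Pi.smul_apply, Pi.sub_apply, Pi.add_apply, smul_eq_mul]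
    ring
  rw [key, Matrix.mulVec_smul, Matrix.mulVec_sub, Matrix.mulVec_add, Matrix.mulVec_smul,
    SimpleGraph.lapMatrix_mulVec_const_eq_zero]
  simp only [Pi.smul_apply, Pi.sub_apply, Pi.add_apply, smul_eq_mul, lapMatrix_mulVec_dist hS h,
    Pi.zero_apply]
  by_cases huw : u = w
  · subst huw
    rw [lapMatrix_mulVec_dist_self]
    simp
  · rw [lapMatrix_mulVec_dist hS huw]
    simp [huw]

/-- Green's representation of a function on a tree by its Laplacian and its value at the root. -/
lemma green_representation (hS : S.IsTree) (r u : V) (f : V → ℝ) :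
    f u = f r + ∑ w, gromov S r u w * (S.lapMatrix ℝ *ᵥ f) w := by
  have h1 := lapMatrix_dotProduct_comm S (gromov S r u) f
  have h2 := sum_lapMatrix_mulVec S (gromov S r u)
  simp only [dotProduct] at h1
  rw [h1]
  have h3 : ∀ w, (S.lapMatrix ℝ *ᵥ gromov S r u) w =
      (if w = u then 1 else 0) - if w = r then 1 else 0 := by
    intro w
    by_cases hw : w = r
    · subst hw
      rw [← Finset.add_sum_erase _ _ (Finset.mem_univ w),
        Finset.sum_congr rfl (fun y hy => lapMatrix_mulVec_gromov hS u (Finset.ne_of_mem_erase hy)),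
        Finset.sum_ite_eq'] at h2
      by_cases huw : u = w
      · subst huw; simp at h2 ⊢; exact h2
      · simp [huw, Ne.symm huw] at h2 ⊢; linarith
    · rw [lapMatrix_mulVec_gromov hS u hw]; simp [hw]
  simp only [h3, mul_sub, Finset.sum_sub_distrib]
  simp

/-- The sum of all Gromov products with `u`. It is the first order term, in the spectral parameter,
of the solution of the eigenvalue equation that is normalized to `1` at the root `r`. -/
noncomputable def totalGromov (S : SimpleGraph V) (r u : V) : ℝ := ∑ w, gromov S r u w

lemma lapMatrix_mulVec_totalGromov (hS : S.IsTree) {r u : V} (h : u ≠ r) :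
    (S.lapMatrix ℝ *ᵥ totalGromov S r) u = 1 := by
  have key : totalGromov S r = ∑ w, gromov S r w := by
    funext y
    simp only [totalGromov, Finset.sum_apply]
    exact Finset.sum_congr rfl fun w _ => gromov_comm _ _ _
  rw [key, Matrix.mulVec_sum, Finset.sum_apply]
  simp_rw [lapMatrix_mulVec_gromov hS _ h]
  simp

omit [DecidableEq V] [DecidableRel S.Adj] in
lemma totalGromov_root (r : V) : totalGromov S r r = 0 := by
  simp [totalGromov, gromov_root]

omit [DecidableEq V] [DecidableRel S.Adj] in
lemma totalGromov_nonneg (hS : S.Connected) (r u : V) : 0 ≤ totalGromov S r u :=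
  Finset.sum_nonneg fun _ _ => gromov_nonneg hS _ _ _

omit [Fintype V] [DecidableEq V] [DecidableRel S.Adj] in
lemma gromov_le_of_adj (hS : S.IsTree) {r u b : V} (hub : S.Adj u b)
    (hd : S.dist r b = S.dist r u + 1) (w : V) : gromov S r u w ≤ gromov S r b w := by
  have h : S.dist b w ≤ S.dist b u + S.dist u w := hS.connected.dist_triangle
  rw [SimpleGraph.dist_eq_one_iff_adj.2 hub.symm] at h
  have h' : (S.dist b w : ℝ) ≤ 1 + S.dist u w := by exact_mod_cast h
  simp only [gromov, hd]
  push_cast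
  linarith

/-- A function with positive Laplacian off the root of a tree strictly increases along every edge
that leads away from the root. -/
lemma lt_of_adj_of_lapMatrix_pos (hS : S.IsTree) {r u b : V} (hub : S.Adj u b)
    (hd : S.dist r b = S.dist r u + 1) {f : V → ℝ}
    (hf : ∀ w, w ≠ r → 0 < (S.lapMatrix ℝ *ᵥ f) w) : f u < f b := by
  rw [green_representation hS r u f, green_representation hS r b f]
  have hbr : b ≠ r := by rintro rfl; simp at hd
  gcongr 1
  refine Finset.sum_lt_sum (fun w _ => ?_) ⟨b, Finset.mem_univ b, ?_⟩
  · by_cases hw : w = r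
    · subst hw
      simp [gromov_comm (S := S) w _ w, gromov_root]
    · exact mul_le_mul_of_nonneg_right (gromov_le_of_adj hS hub hd w) (hf w hw).le
  · refine mul_lt_mul_of_pos_right ?_ (hf b hbr)
    have h1 : S.dist u b = 1 := SimpleGraph.dist_eq_one_iff_adj.2 hub
    rw [gromov_self]
    simp only [gromov, hd, h1]
    push_cast
    linarith

/-- A function with positive Laplacian off the root of a tree attains its maximum only at pendant
vertices different from the root. -/
lemma degree_eq_one_of_isMax (hS : S.IsTree) {r u : V} (hr : S.degree r = 1) {f : V → ℝ}
    (hf : ∀ w, w ≠ r → 0 < (S.lapMatrix ℝ *ᵥ f) w) (hu : ∀ w, f w ≤ f u) :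
    u ≠ r ∧ S.degree u = 1 := by
  have key : ∀ b, S.Adj u b → S.dist r u = S.dist r b + 1 := by
    intro b hb
    rcases hS.dist_eq_dist_add_one_of_adj r hb with h | h
    · exact h
    · exact absurd (hu b) (not_le.2 (lt_of_adj_of_lapMatrix_pos hS hb h hf))
  have hur : u ≠ r := by
    rintro rfl
    obtain ⟨b, hb, -⟩ := SimpleGraph.degree_eq_one_iff_existsUnique_adj.1 hr
    have := key b hb
    simp at this
  refine ⟨hur, SimpleGraph.degree_eq_one_iff_existsUnique_adj.2 ?_⟩
  obtain ⟨a, hua, hd, hb⟩ := exists_closer_neighbor hS hur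
  refine ⟨a, hua, fun b hub => ?_⟩
  by_contra hba
  have h1 := hb b hub hba
  have h2 := key b hub
  omega

end Tree

/-! ### Branches along a path and the slope -/

section Slope

variable {V : Type*} {S : SimpleGraph V}

lemma length_eq_dist_of_isPath (hS : S.IsTree) {a b : V} {w : S.Walk a b} (hw : w.IsPath) :
    w.length = S.dist a b := by
  obtain ⟨w', hw', h⟩ := hS.connected.exists_path_of_dist a b
  rw [← h, (hS.existsUnique_path a b).unique hw hw']

lemma isPath_treePath (hS : S.IsTree) (a b : V) : (treePath hS a b).IsPath :=
  (hS.existsUnique_path a b).choose_spec.1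

/-- The `i`-th associated tree of a path consists of vertices whose Gromov product with the end of
the path is `i`: the walk that leaves the path at its `i`-th vertex can be joined with either part
of the path. -/
lemma gromov_eq_of_mem_associatedTree (hS : S.IsTree) {r v y : V} {p : S.Walk r v} (hp : p.IsPath)
    {i : ℕ} (hi : i ≤ p.length) (hy : y ∈ associatedTree p i) : gromov S r v y = i := by
  classical
  obtain ⟨q₀, hq₀⟩ := hy
  set q := q₀.bypass with hq
  have hqp : q.IsPath := q₀.bypass_isPath
  have hqs : ∀ z ∈ q.support, z ∈ p.support → z = p.getVert i := fun z hz =>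
    hq₀ z (q₀.support_bypass_subset_support hz)
  have hsplit : ∀ {b : V} (w : S.Walk (p.getVert i) b), w.IsPath →
      (∀ z ∈ w.support, z ∈ p.support) → S.dist y b = S.dist y (p.getVert i) + w.length := by
    intro b w hw hsub
    have happ : (q.append w).IsPath := by
      rw [SimpleGraph.Walk.isPath_def, SimpleGraph.Walk.support_append, List.nodup_append']
      refine ⟨hqp.support_nodup, hw.support_nodup.tail, fun z hz hz' => ?_⟩
      have hz1 := hqs z hz (hsub z (List.mem_of_mem_tail hz'))
      have := hw.support_nodup
      rw [← SimpleGraph.Walk.cons_tail_support, List.nodup_cons] at this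
      exact this.1 (hz1 ▸ hz')
    rw [← length_eq_dist_of_isPath hS happ, ← length_eq_dist_of_isPath hS hqp,
      SimpleGraph.Walk.length_append]
  have h1 := hsplit (p.drop i) (hp.drop i) fun z hz =>
    (p.isSubwalk_drop i).support_subset hz
  have h2 := hsplit (p.take i).reverse (hp.take i).reverse fun z hz =>
    (p.isSubwalk_take i).support_subset (by simpa using hz)
  rw [SimpleGraph.Walk.length_reverse, SimpleGraph.Walk.take_length] at h2
  rw [SimpleGraph.Walk.drop_length] at h1
  have h3 := (length_eq_dist_of_isPath hS hp).symm
  have h4 : (S.dist y v : ℝ) = S.dist y (p.getVert i) + (p.length - i) := by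
    rw [h1]; push_cast [hi]; ring
  have h5 : (S.dist y r : ℝ) = S.dist y (p.getVert i) + i := by
    rw [h2, min_eq_left hi]; push_cast; ring
  rw [gromov, S.dist_comm (u := r) (v := y), S.dist_comm (u := v) (v := y), h4, h5, h3]
  ring

lemma exists_mem_associatedTree (hS : S.Connected) {r v : V} (p : S.Walk r v) (y : V) :
    ∃ i ≤ p.length, y ∈ associatedTree p i := by
  classical
  obtain ⟨x, hx, hmin⟩ := Finset.exists_min_image p.support.toFinset (fun x => S.dist y x)
    ⟨r, by simp⟩
  rw [List.mem_toFinset, SimpleGraph.Walk.mem_support_iff_exists_getVert] at hx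
  obtain ⟨i, rfl, hi⟩ := hx
  obtain ⟨q, hq⟩ := hS.exists_walk_length_eq_dist y (p.getVert i)
  refine ⟨i, hi, q, fun z hz hzp => ?_⟩
  have h1 := hmin z (List.mem_toFinset.2 hzp)
  have h2 : S.dist y z ≤ (q.takeUntil z hz).length := S.dist_le _
  by_contra hne
  have h3 := q.length_takeUntil_lt_length hz hne
  omega

/-- A vertex other than the pendant vertex `v` shares at most `d(r, v) - 1` edges with the path
from `r` to `v`. -/
lemma gromov_ne_dist_of_pendant [Fintype V] [DecidableRel S.Adj] (hS : S.IsTree) {r v y : V}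
    (hv : S.degree v = 1) (hvr : v ≠ r) (hy : y ≠ v) : gromov S r v y ≠ S.dist r v := by
  obtain ⟨a, ha, hau⟩ := SimpleGraph.degree_eq_one_iff_existsUnique_adj.1 hv
  obtain ⟨b, hb, hbd, -⟩ := exists_closer_neighbor hS hvr
  obtain ⟨c, hc, hcd, -⟩ := exists_closer_neighbor hS hy.symm
  obtain rfl := hau b hb
  obtain rfl := hau c hc
  have h : S.dist r y ≤ S.dist r c + S.dist c y := hS.connected.dist_triangle
  rw [S.dist_comm (u := c)] at h
  have h' : (S.dist r y : ℝ) ≤ S.dist r c + S.dist y c := by exact_mod_cast h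
  rw [gromov, S.dist_comm (u := v) (v := y), hbd, hcd]
  push_cast
  intro h2
  linarith

variable [Fintype V]

lemma totalGromov_eq_sum_ncard (hS : S.IsTree) {r v : V} {p : S.Walk r v} (hp : p.IsPath) :
    totalGromov S r v = ∑ i ∈ Finset.range (p.length + 1),
      (i : ℝ) * ((associatedTree p i).ncard : ℝ) := by
  classical
  choose f hf hfm using exists_mem_associatedTree hS.connected p
  have hfg : ∀ y, gromov S r v y = f y := fun y =>
    gromov_eq_of_mem_associatedTree hS hp (hf y) (hfm y)
  have hset : ∀ i ∈ Finset.range (p.length + 1),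
      associatedTree p i = ↑({y | f y = i} : Finset V) := by
    intro i hi
    ext y
    simp only [Finset.coe_filter, Finset.mem_univ, true_and, Set.mem_ofPred_eq]
    constructor
    · intro hy
      have := gromov_eq_of_mem_associatedTree hS hp (by simpa [Nat.lt_succ_iff] using hi) hy
      rw [hfg] at this
      exact_mod_cast this
    · rintro rfl
      exact hfm y
  rw [totalGromov, Finset.sum_congr rfl (fun y _ => hfg y),
    ← Finset.sum_fiberwise_of_maps_to (g := f) (t := Finset.range (p.length + 1))
      (fun y _ => by simpa [Nat.lt_succ_iff] using hf y)]
  refine Finset.sum_congr rfl fun i hi => ?_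
  rw [hset i hi, Set.ncard_coe_finset, Finset.sum_congr rfl (g := fun _ => (i : ℝ))]
  · simp [mul_comm]
  · intro y hy
    rw [(Finset.mem_filter.1 hy).2]

/-- The total Gromov product exceeds the negative slope only by the contribution of the vertices
beyond `v`, of which the slope counts `v` alone. -/
lemma totalGromov_eq_neg_slope_add (hS : S.IsTree) (r v : V) :
    totalGromov S r v = -slope hS r v +
      (S.dist r v : ℝ) * (((associatedTree (treePath hS r v) (S.dist r v)).ncard : ℝ) - 1) := by
  have hp := isPath_treePath hS r v
  have hlen := length_eq_dist_of_isPath hS hp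
  rw [totalGromov_eq_sum_ncard hS hp, hlen, Finset.sum_range_succ, slope]
  have : ∑ i ∈ Finset.range (S.dist r v), (i : ℝ) *
        ((associatedTree (treePath hS r v) i).ncard : ℝ) =
      ∑ i ∈ Finset.Icc 1 (S.dist r v - 1), (i : ℝ) *
        ((associatedTree (treePath hS r v) i).ncard : ℝ) := by
    symm
    refine Finset.sum_subset ?_ ?_
    · intro i hi
      simp only [Finset.mem_Icc, Finset.mem_range] at hi ⊢
      omega
    · intro i hi hi'
      simp only [Finset.mem_Icc, Finset.mem_range] at hi hi'
      have : i = 0 := by omega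
      simp [this]
  rw [this]
  ring

lemma neg_slope_le_totalGromov (hS : S.IsTree) (r v : V) :
    -slope hS r v ≤ totalGromov S r v := by
  have hp := isPath_treePath hS r v
  have hlen := length_eq_dist_of_isPath hS hp
  rw [totalGromov_eq_neg_slope_add hS]
  have hmem : v ∈ associatedTree (treePath hS r v) (S.dist r v) := by
    have : (treePath hS r v).getVert (S.dist r v) = v := by
      rw [← hlen, SimpleGraph.Walk.getVert_length]
    refine ⟨(SimpleGraph.Walk.nil : S.Walk v v).copy rfl this.symm, ?_⟩
    simp [this]
  have h1 : 1 ≤ (associatedTree (treePath hS r v) (S.dist r v)).ncard :=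
    (Set.ncard_pos (Set.toFinite _)).2 ⟨v, hmem⟩
  have h2 : (1 : ℝ) ≤ (associatedTree (treePath hS r v) (S.dist r v)).ncard := by exact_mod_cast h1
  have : 0 ≤ (S.dist r v : ℝ) *
      (((associatedTree (treePath hS r v) (S.dist r v)).ncard : ℝ) - 1) :=
    mul_nonneg (Nat.cast_nonneg _) (by linarith)
  linarith

lemma totalGromov_eq_neg_slope [DecidableRel S.Adj] (hS : S.IsTree) {r v : V}
    (hv : S.degree v = 1) : totalGromov S r v = -slope hS r v := by
  refine le_antisymm ?_ (neg_slope_le_totalGromov hS r v)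
  by_cases hvr : v = r
  · rw [totalGromov_eq_neg_slope_add hS]
    subst hvr
    simp
  have hp := isPath_treePath hS r v
  have hlen := length_eq_dist_of_isPath hS hp
  rw [totalGromov_eq_neg_slope_add hS]
  have hsub : associatedTree (treePath hS r v) (S.dist r v) ⊆ {v} := by
    intro y hy
    by_contra hne
    exact gromov_ne_dist_of_pendant hS hv hvr hne
      (gromov_eq_of_mem_associatedTree hS hp hlen.ge hy)
  have h1 := Set.ncard_le_ncard hsub
  rw [Set.ncard_singleton] at h1
  have h2 : ((associatedTree (treePath hS r v) (S.dist r v)).ncard : ℝ) ≤ 1 := by exact_mod_cast h1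
  have : (S.dist r v : ℝ) *
      (((associatedTree (treePath hS r v) (S.dist r v)).ncard : ℝ) - 1) ≤ 0 :=
    mul_nonpos_of_nonneg_of_nonpos (Nat.cast_nonneg _) (by linarith)
  linarith

/-- The total Gromov product is a natural number. -/
lemma exists_nat_eq_totalGromov (hS : S.IsTree) (r v : V) :
    ∃ N : ℕ, totalGromov S r v = N := by
  obtain ⟨p, hp, -⟩ := hS.existsUnique_path r v
  rw [totalGromov_eq_sum_ncard hS hp]
  exact ⟨∑ i ∈ Finset.range (p.length + 1), i * (associatedTree p i).ncard, by push_cast; rfl⟩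

variable [DecidableEq V] [DecidableRel S.Adj]

/-- A unique minimizer of the slope is the unique maximizer of the total Gromov product, because a
maximizer of the latter is pendant and hence a minimizer of the slope. -/
lemma totalGromov_lt_of_slope_lt (hS : S.IsTree) {r v : V} (hr : S.degree r = 1)
    (hv : ∀ u, u ≠ v → slope hS r v < slope hS r u) {u : V} (hu : u ≠ v) :
    totalGromov S r u < totalGromov S r v := by
  have : Nonempty V := ⟨v⟩
  have hmax : ∀ w, (∀ u, totalGromov S r u ≤ totalGromov S r w) → w = v := by
    intro w hw
    have hw1 := (degree_eq_one_of_isMax hS hr (fun x hx => by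
      rw [lapMatrix_mulVec_totalGromov hS hx]; exact one_pos) hw).2
    by_contra hne
    have h1 := hv w hne
    have h2 := totalGromov_eq_neg_slope hS (r := r) hw1
    have h3 := neg_slope_le_totalGromov hS r v
    have h4 := hw v
    linarith
  obtain ⟨w, hw⟩ := Finite.exists_max (totalGromov S r)
  obtain rfl := hmax w hw
  refine lt_of_le_of_ne (hw u) fun h => hu (hmax u fun x => ?_)
  rw [h]
  exact hw x

end Slope

/-! ### Spectral bounds for quadratic forms -/

section Spectral

variable {V : Type*} [Fintype V] [DecidableEq V]

lemma mem_spectrum_of_mulVec_eq {M : Matrix V V ℝ} {t : ℝ} {x : V → ℝ} (hx : x ≠ 0)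
    (h : M *ᵥ x = t • x) : t ∈ spectrum ℝ M := by
  rw [← Matrix.spectrum_toLin']
  refine Module.End.HasEigenvalue.mem_spectrum
    (Module.End.hasEigenvalue_of_hasEigenvector (x := x) ⟨?_, hx⟩)
  rw [Module.End.mem_eigenspace_iff, Matrix.toLin'_apply, h]

lemma posSemidef_of_eigenvalue_nonneg {M : Matrix V V ℝ} (hM : M.IsHermitian)
    (h : ∀ (t : ℝ) (x : V → ℝ), x ≠ 0 → M *ᵥ x = t • x → 0 ≤ t) : M.PosSemidef := by
  rw [hM.posSemidef_iff_eigenvalues_nonneg]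
  intro i
  refine h _ (hM.eigenvectorBasis i).ofLp ?_ (hM.mulVec_eigenvectorBasis i)
  intro h0
  apply hM.eigenvectorBasis.orthonormal.ne_zero i
  ext j
  exact congrFun h0 j

lemma lambdaMin_mul_le {M : Matrix V V ℝ} (hM : M.IsHermitian) (x : V → ℝ) :
    lambdaMin M * (x ⬝ᵥ x) ≤ x ⬝ᵥ (M *ᵥ x) := by
  have hps : (M - lambdaMin M • (1 : Matrix V V ℝ)).PosSemidef := by
    refine posSemidef_of_eigenvalue_nonneg (hM.sub ?_) fun t y hy hty => ?_
    · exact Matrix.isHermitian_one.smul (IsSelfAdjoint.all _)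
    · have h1 : M *ᵥ y = (t + lambdaMin M) • y := by
        rw [Matrix.sub_mulVec, Matrix.smul_mulVec, Matrix.one_mulVec] at hty
        rw [add_smul, ← hty, sub_add_cancel]
      have h2 : lambdaMin M ≤ t + lambdaMin M :=
        csInf_le M.finite_real_spectrum.bddBelow (mem_spectrum_of_mulVec_eq hy h1)
      linarith
  have h := hps.dotProduct_mulVec_nonneg x
  rw [Matrix.sub_mulVec, Matrix.smul_mulVec, Matrix.one_mulVec, dotProduct_sub,
    dotProduct_smul, star_trivial, smul_eq_mul] at h
  linarith

end Spectral

/-! ### The eigenvalue equation on a rooted tree -/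

section Profile

variable {V : Type*} [Fintype V] [DecidableEq V] {S : SimpleGraph V} [DecidableRel S.Adj]

lemma sum_eq_sum_subtype_ne {r : V} {f : V → ℝ} (hf : f r = 0) :
    ∑ u, f u = ∑ u : {u : V // u ≠ r}, f u.1 := by
  rw [← Finset.sum_erase _ hf]
  exact Finset.sum_subtype _ (by simp) f

/-- The smallest eigenvalue of the reduced Laplacian bounds the energy of the functions that vanish
at the root. -/
lemma lambdaMin_reducedLaplacian_mul_le {r : V} {f : V → ℝ} (hf : f r = 0) :
    lambdaMin (reducedLaplacian S r) * (f ⬝ᵥ f) ≤ f ⬝ᵥ (S.lapMatrix ℝ *ᵥ f) := by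
  have hH : (reducedLaplacian S r).IsHermitian := (S.isHermitian_lapMatrix ℝ).submatrix _
  have h := lambdaMin_mul_le hH (fun u => f u.1)
  have h1 : f ⬝ᵥ f = (fun u : {u : V // u ≠ r} => f u.1) ⬝ᵥ fun u => f u.1 :=
    sum_eq_sum_subtype_ne (f := fun u => f u * f u) (by simp [hf])
  have h2 : ∀ u : {u : V // u ≠ r}, (reducedLaplacian S r *ᵥ fun u => f u.1) u =
      (S.lapMatrix ℝ *ᵥ f) u.1 := fun u =>
    (sum_eq_sum_subtype_ne (f := fun w => S.lapMatrix ℝ u.1 w * f w) (by simp [hf])).symm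
  have h3 : f ⬝ᵥ (S.lapMatrix ℝ *ᵥ f) =
      (fun u : {u : V // u ≠ r} => f u.1) ⬝ᵥ (reducedLaplacian S r *ᵥ fun u => f u.1) := by
    simp only [dotProduct, h2]
    exact sum_eq_sum_subtype_ne (f := fun u => f u * (S.lapMatrix ℝ *ᵥ f) u) (by simp [hf])
  rw [h1, h3]
  exact h

variable (S) in
/-- The solutions of the eigenvalue equation of the Laplacian at all vertices except the root `r`,
normalized by the value `1` at the root. -/
structure IsProfile (r : V) (μ : ℝ) (h : V → ℝ) : Prop where
  root : h r = 1
  eq : ∀ u, u ≠ r → (S.lapMatrix ℝ *ᵥ h) u = μ * h u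

lemma eq_zero_of_eigen_off_root {r : V} {μ : ℝ} (hμ : μ < lambdaMin (reducedLaplacian S r))
    {f : V → ℝ} (hr : f r = 0) (hf : ∀ u, u ≠ r → (S.lapMatrix ℝ *ᵥ f) u = μ * f u) : f = 0 := by
  have h1 := lambdaMin_reducedLaplacian_mul_le (S := S) hr
  have h2 : f ⬝ᵥ (S.lapMatrix ℝ *ᵥ f) = μ * (f ⬝ᵥ f) := by
    rw [dotProduct, dotProduct, Finset.mul_sum]
    refine Finset.sum_congr rfl fun u _ => ?_
    by_cases hu : u = r
    · simp [hu, hr]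
    · rw [hf u hu]; ring
  have h3 : 0 ≤ f ⬝ᵥ f := Finset.sum_nonneg fun u _ => mul_self_nonneg _
  have h4 : f ⬝ᵥ f = 0 := by nlinarith
  exact dotProduct_self_eq_zero.1 h4

lemma exists_isProfile {r : V} {μ : ℝ} (hμ : μ < lambdaMin (reducedLaplacian S r)) :
    ∃ h, IsProfile S r μ h := by
  let Φ : (V → ℝ) →ₗ[ℝ] (V → ℝ) :=
    { toFun := fun f u => if u = r then f r else (S.lapMatrix ℝ *ᵥ f) u - μ * f u
      map_add' := fun f g => by
        funext u
        by_cases hu : u = r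
        · simp [hu]
        · simp only [hu, if_false, Matrix.mulVec_add, Pi.add_apply]; ring
      map_smul' := fun c f => by
        funext u
        by_cases hu : u = r
        · simp [hu]
        · simp only [hu, if_false, Matrix.mulVec_smul, Pi.smul_apply, smul_eq_mul,
            RingHom.id_apply]; ring }
  have hΦ : ∀ f u, Φ f u = if u = r then f r else (S.lapMatrix ℝ *ᵥ f) u - μ * f u :=
    fun _ _ => rfl
  have hinj : Function.Injective Φ := by
    rw [← LinearMap.ker_eq_bot, LinearMap.ker_eq_bot']
    intro f hf
    refine eq_zero_of_eigen_off_root hμ (r := r) ?_ fun u hu => ?_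
    · simpa [hΦ] using congrFun hf r
    · have := congrFun hf u
      rw [hΦ, if_neg hu] at this
      simpa [sub_eq_zero] using this
  obtain ⟨h, hh⟩ := LinearMap.injective_iff_surjective.1 hinj (Pi.single r 1)
  refine ⟨h, ?_, fun u hu => ?_⟩
  · simpa [hΦ] using congrFun hh r
  · have := congrFun hh u
    rw [hΦ, if_neg hu, Pi.single_eq_of_ne hu] at this
    linarith

namespace IsProfile

variable {r : V} {μ : ℝ} {h : V → ℝ}

/-- Functions that solve the eigenvalue equation off the root are multiples of the profile. -/
lemma eq_mul (hh : IsProfile S r μ h) (hμ : μ < lambdaMin (reducedLaplacian S r)) {f : V → ℝ}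
    (hf : ∀ u, u ≠ r → (S.lapMatrix ℝ *ᵥ f) u = μ * f u) (u : V) : f u = f r * h u := by
  have := eq_zero_of_eigen_off_root (f := f - f r • h) hμ (by simp [hh.root]) fun u hu => by
    simp only [Matrix.mulVec_sub, Matrix.mulVec_smul, Pi.sub_apply, Pi.smul_apply, smul_eq_mul,
      hf u hu, hh.eq u hu]
    ring
  have := congrFun this u
  simp only [Pi.sub_apply, Pi.smul_apply, smul_eq_mul, Pi.zero_apply] at this
  linarith

/-- The negative part of a profile vanishes: its energy is at most `μ` times its squared norm,
because the off-diagonal entries of the Laplacian are nonpositive. -/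
lemma nonneg (hh : IsProfile S r μ h) (hμ : μ < lambdaMin (reducedLaplacian S r)) (u : V) :
    0 ≤ h u := by
  set f : V → ℝ := fun u => max (-h u) 0 with hf
  have hfr : f r = 0 := by simp [hf, hh.root]
  have h1 := lambdaMin_reducedLaplacian_mul_le (S := S) hfr
  have hpos : ∀ u, 0 ≤ f u := fun u => le_max_right _ _
  have hfh : ∀ u, f u * h u = -(f u * f u) := by
    intro u
    rcases le_total 0 (h u) with h0 | h0
    · simp [hf, h0]
    · simp [hf, max_eq_left (neg_nonneg.2 h0)]
  have h2 : f ⬝ᵥ (S.lapMatrix ℝ *ᵥ h) = -(μ * (f ⬝ᵥ f)) := by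
    rw [dotProduct, dotProduct, Finset.mul_sum, ← Finset.sum_neg_distrib]
    refine Finset.sum_congr rfl fun u _ => ?_
    by_cases hu : u = r
    · simp [hu, hfr]
    · rw [hh.eq u hu, ← mul_assoc, mul_comm (f u), mul_assoc, hfh]; ring
  have h3 : f ⬝ᵥ (S.lapMatrix ℝ *ᵥ h) ≤ -(f ⬝ᵥ (S.lapMatrix ℝ *ᵥ f)) := by
    rw [dotProduct, dotProduct, ← Finset.sum_neg_distrib]
    refine Finset.sum_le_sum fun p _ => ?_
    rw [lapMatrix_mulVec_eq_sum, lapMatrix_mulVec_eq_sum, Finset.mul_sum, Finset.mul_sum,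
      ← Finset.sum_neg_distrib]
    refine Finset.sum_le_sum fun q _ => ?_
    by_cases hpq : S.Adj p q
    · simp only [hpq, if_true]
      have h4 := hfh p
      have h5 : -f q ≤ h q := by
        have : -h q ≤ f q := le_max_left _ _
        linarith
      have h6 := mul_le_mul_of_nonneg_left h5 (hpos p)
      linarith
    · simp [hpq]
  have h4 : 0 ≤ f ⬝ᵥ f := Finset.sum_nonneg fun u _ => mul_self_nonneg _
  have h5 : f ⬝ᵥ f = 0 := by nlinarith
  have h6 := congrFun (dotProduct_self_eq_zero.1 h5) u
  have h7 : -h u ≤ f u := le_max_left _ _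
  rw [h6] at h7
  simpa using h7

lemma eq_one_add (hh : IsProfile S r μ h) (hS : S.IsTree) (u : V) :
    h u = 1 + μ * ∑ w, gromov S r u w * h w := by
  rw [green_representation hS r u h, hh.root, Finset.mul_sum]
  congr 1
  refine Finset.sum_congr rfl fun w _ => ?_
  by_cases hw : w = r
  · subst hw
    simp [gromov_comm (S := S) w u w, gromov_root]
  · rw [hh.eq w hw]; ring

variable (hh : IsProfile S r μ h) (hS : S.IsTree) (hμ : μ < lambdaMin (reducedLaplacian S r))
  (hμ0 : 0 < μ)

include hh hS hμ hμ0

lemma one_le (u : V) : 1 ≤ h u := by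
  rw [hh.eq_one_add hS]
  have : 0 ≤ ∑ w, gromov S r u w * h w :=
    Finset.sum_nonneg fun w _ => mul_nonneg (gromov_nonneg hS.connected _ _ _) (hh.nonneg hμ w)
  nlinarith

lemma lapMatrix_pos (u : V) (hu : u ≠ r) : 0 < (S.lapMatrix ℝ *ᵥ h) u := by
  rw [hh.eq u hu]
  exact mul_pos hμ0 (one_pos.trans_le (hh.one_le hS hμ hμ0 u))

lemma one_add_mul_le (u : V) : 1 + μ * totalGromov S r u ≤ h u := by
  rw [hh.eq_one_add hS, totalGromov]
  gcongr 1 + μ * ?_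
  refine Finset.sum_le_sum fun w _ => ?_
  exact le_mul_of_one_le_right (gromov_nonneg hS.connected _ _ _) (hh.one_le hS hμ hμ0 w)

omit hμ in
lemma le_one_add_mul {M : ℝ} (hM : ∀ u, h u ≤ M) (u : V) :
    h u ≤ 1 + μ * (M * totalGromov S r u) := by
  rw [hh.eq_one_add hS, totalGromov, Finset.mul_sum _ _ M]
  gcongr 1 + μ * ?_
  refine Finset.sum_le_sum fun w _ => ?_
  rw [mul_comm M]
  exact mul_le_mul_of_nonneg_left (hM w) (gromov_nonneg hS.connected _ _ _)

lemma one_lt (u : V) (hu : u ≠ r) : 1 < h u := by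
  refine lt_of_lt_of_le ?_ (hh.one_add_mul_le hS hμ hμ0 u)
  have h1 : gromov S r u u ≤ totalGromov S r u :=
    Finset.single_le_sum (f := gromov S r u) (fun w _ => gromov_nonneg hS.connected _ _ _)
      (Finset.mem_univ u)
  rw [gromov_self] at h1
  have h2 : 0 < S.dist r u := hS.connected.pos_dist_of_ne hu.symm
  have h3 : (0 : ℝ) < S.dist r u := by exact_mod_cast h2
  have := mul_pos hμ0 (h3.trans_le h1)
  linarith

/-- For small `μ` a profile is `1 + μ H + O(μ²)`, where `H` is the total Gromov product. As `H` is
integer-valued, its unique maximizer is the unique maximizer of the profile. -/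
lemma lt_of_totalGromov_lt {v : V}
    (hv : ∀ u, u ≠ v → totalGromov S r u < totalGromov S r v)
    (hsmall : μ * totalGromov S r v ^ 2 < 1) {u : V} (hu : u ≠ v) : h u < h v := by
  have : Nonempty V := ⟨v⟩
  obtain ⟨w, hw⟩ := Finite.exists_max h
  set B := totalGromov S r v
  set M := h w
  have hM1 : 1 ≤ M := hh.one_le hS hμ hμ0 w
  have hB : ∀ x, totalGromov S r x ≤ B := fun x => by
    by_cases hx : x = v
    · rw [hx]
    · exact (hv x hx).le
  have huB : totalGromov S r u ≤ B - 1 := by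
    obtain ⟨a, ha⟩ := exists_nat_eq_totalGromov hS r u
    obtain ⟨b, hb⟩ := exists_nat_eq_totalGromov hS r v
    have h1 := hv u hu
    change B = b at hb
    rw [ha, hb] at h1 ⊢
    have h2 : a + 1 ≤ b := by exact_mod_cast h1
    have h3 : (a : ℝ) + 1 ≤ b := by exact_mod_cast h2
    linarith
  have hu0 := totalGromov_nonneg hS.connected r u
  have hB1 : 1 ≤ B := by linarith
  have h1 := hh.one_add_mul_le hS hμ hμ0 v
  have h2 := hh.le_one_add_mul hS hμ0 hw u
  have h3 : M ≤ 1 + μ * (M * B) := (hh.le_one_add_mul hS hμ0 hw w).trans (by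
    have := hB w
    gcongr)
  have h4 : M * (B - 1) < B := by
    by_contra hcon
    push Not at hcon
    have h5 : M * B ≤ B + μ * B ^ 2 * M := by nlinarith
    nlinarith
  have h6 : M * totalGromov S r u ≤ M * (B - 1) := by gcongr
  have h7 : μ * (M * totalGromov S r u) < μ * B := mul_lt_mul_of_pos_left (by linarith) hμ0
  change 1 + μ * B ≤ h v at h1
  linarith

end IsProfile

end Profile

/-! ### A weighted eigenvalue equation on a path -/

section Path

/-- The values `z 0, …, z n` satisfy the weighted eigenvalue equation `L z = ρ z` on the path with
vertices `0, …, n`. The free boundary conditions are encoded by `z (n + 1) = z n` at the right end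
and by truncated subtraction, `z (0 - 1) = z 0`, at the left end. -/
structure IsPathEigen (n : ℕ) (ρ z : ℕ → ℝ) : Prop where
  boundary : z (n + 1) = z n
  eq : ∀ i ≤ n, 2 * z i - z (i + 1) - z (i - 1) = ρ i * z i

variable {n : ℕ} {ρ z : ℕ → ℝ}

namespace IsPathEigen

lemma flux (hz : IsPathEigen n ρ z) {i : ℕ} (hi : i ≤ n) :
    z i - z (i + 1) = ∑ j ∈ Finset.range (i + 1), ρ j * z j := by
  induction i with
  | zero =>
    have := hz.eq 0 hi
    simp at this ⊢
    linarith
  | succ i ih =>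
    rw [Finset.sum_range_succ, ← ih (by omega), ← hz.eq (i + 1) hi]
    simp
    ring

lemma sum_eq_zero (hz : IsPathEigen n ρ z) : ∑ j ∈ Finset.range (n + 1), ρ j * z j = 0 := by
  rw [← hz.flux le_rfl, hz.boundary, sub_self]

lemma eq_zero (hz : IsPathEigen n ρ z) (h0 : z 0 = 0) {i : ℕ} (hi : i ≤ n + 1) : z i = 0 := by
  induction i using Nat.strong_induction_on with
  | _ i ih =>
    cases i with
    | zero => exact h0
    | succ i =>
      have h1 := hz.flux (i := i) (by omega)
      rw [ih i (by omega) (by omega), Finset.sum_eq_zero] at h1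
      · linarith
      · intro j hj
        rw [Finset.mem_range] at hj
        rw [ih j (by omega) (by omega), mul_zero]

/-- The energy of a modulated eigenfunction `κ z`, relative to the weight `ρ`, is localized at the
edges on which `κ` changes. -/
lemma energy_modulated (hz : IsPathEigen n ρ z) (κ : ℕ → ℝ) {N : ℕ} (hN : N ≤ n) :
    ∑ i ∈ Finset.range (N + 1), κ i * z i *
        (2 * (κ i * z i) - κ (i + 1) * z (i + 1) - κ (i - 1) * z (i - 1) - ρ i * (κ i * z i)) =
      κ N * (κ N - κ (N + 1)) * (z N * z (N + 1)) +
        ∑ i ∈ Finset.range N, (κ i - κ (i + 1)) ^ 2 * (z i * z (i + 1)) := by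
  induction N with
  | zero =>
    have h := hz.eq 0 hN
    simp only [zero_add, Finset.sum_range_one, zero_le, Nat.sub_eq_zero_of_le, Finset.range_zero,
      Finset.sum_empty, add_zero] at h ⊢
    linear_combination ((κ 0) ^ 2 * z 0) * h
  | succ N ih =>
    have h := hz.eq (N + 1) hN
    rw [Finset.sum_range_succ, ih (by omega), Finset.sum_range_succ _ N]
    simp only [Nat.add_sub_cancel] at h ⊢
    linear_combination ((κ (N + 1)) ^ 2 * z (N + 1)) * h

variable {μ : ℝ} (hz : IsPathEigen n ρ z) (hμ : 0 < μ) (hρ : ∀ i ≤ n, μ ≤ ρ i)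
  (hmin : ∀ w : ℕ → ℝ, w (n + 1) = w n → ∑ i ∈ Finset.range (n + 1), ρ i * w i = 0 →
    ∑ i ∈ Finset.range (n + 1), w i * (2 * w i - w (i + 1) - w (i - 1) - ρ i * w i) ≤ 0 →
    IsPathEigen n ρ w)
  (h0 : 0 < z 0)

include hz hμ hρ hmin h0

/-- The nodal domain theorem on the path. If the energy minus the weighted norm is nonnegative on
the functions of weighted mean zero, and vanishes there only on eigenfunctions, then an
eigenfunction changes its sign exactly once: with three nodal intervals, a combination of the
restrictions of the eigenfunction to two of them would be an eigenfunction that vanishes on the third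
one. -/
lemma exists_sign_change : ∃ m, 0 < m ∧ m ≤ n ∧ (∀ j < m, 0 < z j) ∧ z m ≤ 0 ∧
    ∀ j, m < j → j ≤ n → z j < 0 := by
  classical
  have hρ0 : ∀ i ≤ n, 0 < ρ i := fun i hi => hμ.trans_le (hρ i hi)
  have hex : ∃ m, m ≤ n ∧ z m ≤ 0 := by
    by_contra hcon
    push Not at hcon
    have : 0 < ∑ j ∈ Finset.range (n + 1), ρ j * z j := Finset.sum_pos (fun j hj => by
      have hj' : j ≤ n := by simpa [Nat.lt_succ_iff] using hj
      exact mul_pos (hρ0 j hj') (hcon j hj')) ⟨0, by simp⟩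
    rw [hz.sum_eq_zero] at this
    exact lt_irrefl _ this
  set m := Nat.find hex with hm
  obtain ⟨hmn, hzm⟩ : m ≤ n ∧ z m ≤ 0 := Nat.find_spec hex
  have hpos : ∀ j < m, 0 < z j := fun j hj => by
    have := Nat.find_min hex hj
    by_contra hcon
    exact this ⟨by omega, not_lt.1 hcon⟩
  have hm0 : 0 < m := by
    rcases Nat.eq_zero_or_pos m with h | h
    · rw [h] at hzm; exact absurd hzm (not_le.2 h0)
    · exact h
  refine ⟨m, hm0, hmn, hpos, hzm, ?_⟩
  have hA : 0 < ∑ j ∈ Finset.range m, ρ j * z j := Finset.sum_pos (fun j hj => by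
    rw [Finset.mem_range] at hj
    exact mul_pos (hρ0 j (by omega)) (hpos j hj)) ⟨0, by simpa using hm0⟩
  by_contra hcon
  push Not at hcon
  have hex' : ∃ j, m < j ∧ j ≤ n ∧ 0 ≤ z j := hcon
  set j := Nat.find hex' with hj
  obtain ⟨hmj, hjn, hzj⟩ : m < j ∧ j ≤ n ∧ 0 ≤ z j := Nat.find_spec hex'
  obtain ⟨t, ht⟩ : ∃ t, j = t + 1 := ⟨j - 1, by omega⟩
  rw [ht] at hmj hjn hzj
  have hzt : z t < 0 := by
    rcases Nat.lt_or_ge m t with h | h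
    · have := Nat.find_min hex' (m := t) (by omega)
      by_contra hcon'
      exact this ⟨h, by omega, not_lt.1 hcon'⟩
    · obtain rfl : t = m := by omega
      refine lt_of_le_of_ne hzm fun h0 => ?_
      have h1 := hz.flux (i := m) hmn
      rw [Finset.sum_range_succ, h0] at h1
      linarith
  set A := ∑ j ∈ Finset.range m, ρ j * z j with hAdef
  set B := ∑ j ∈ Finset.Ico m (t + 1), ρ j * z j with hBdef
  -- The coefficients on the first two intervals are chosen to give weighted mean zero.
  set κ : ℕ → ℝ := fun i => if i < m then -B else if i ≤ t then A else 0 with hκ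
  have hκ1 : ∀ i, i < m → κ i = -B := fun i hi => by simp [hκ, hi]
  have hκ2 : ∀ i, m ≤ i → i ≤ t → κ i = A := fun i hi hi' => by simp [hκ, not_lt.2 hi, hi']
  have hκ3 : ∀ i, t < i → κ i = 0 := fun i hi => by
    simp [hκ, not_lt.2 (show m ≤ i by omega), not_le.2 hi]
  have hw : IsPathEigen n ρ (fun i => κ i * z i) := by
    refine hmin _ ?_ ?_ ?_
    · simp only [hκ3 n (by omega), hκ3 (n + 1) (by omega), zero_mul]
    · rw [Finset.range_eq_Ico, ← Finset.sum_Ico_consecutive _ (Nat.zero_le m) (by omega),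
        ← Finset.sum_Ico_consecutive _ (show m ≤ t + 1 by omega) (by omega)]
      rw [Finset.sum_congr rfl (g := fun i => -B * (ρ i * z i)),
        Finset.sum_congr (s₁ := Finset.Ico m (t + 1)) rfl (g := fun i => A * (ρ i * z i)),
        Finset.sum_eq_zero (s := Finset.Ico (t + 1) (n + 1)), ← Finset.mul_sum, ← Finset.mul_sum,
        ← Finset.range_eq_Ico, ← hAdef, ← hBdef]
      · ring
      · intro i hi
        rw [Finset.mem_Ico] at hi
        rw [hκ3 i (by omega)]; ring
      · intro i hi
        rw [Finset.mem_Ico] at hi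
        rw [hκ2 i (by omega) (by omega)]; ring
      · intro i hi
        rw [Finset.mem_Ico] at hi
        rw [hκ1 i (by omega)]; ring
    · rw [hz.energy_modulated κ le_rfl, hκ3 n (by omega), zero_mul, zero_mul, zero_add]
      refine Finset.sum_nonpos fun i hi => ?_
      rw [Finset.mem_range] at hi
      by_cases h1 : i + 1 = m
      · refine mul_nonpos_of_nonneg_of_nonpos (sq_nonneg _)
          (mul_nonpos_of_nonneg_of_nonpos (hpos i (by omega)).le ?_)
        rw [h1]; exact hzm
      by_cases h2 : i = t
      · subst h2
        exact mul_nonpos_of_nonneg_of_nonpos (sq_nonneg _)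
          (mul_nonpos_of_nonpos_of_nonneg hzt.le hzj)
      have : κ i = κ (i + 1) := by
        rcases Nat.lt_or_ge i m with h3 | h3
        · rw [hκ1 i h3, hκ1 (i + 1) (by omega)]
        · rcases Nat.lt_or_ge i t with h4 | h4
          · rw [hκ2 i h3 h4.le, hκ2 (i + 1) (by omega) (by omega)]
          · rw [hκ3 i (by omega), hκ3 (i + 1) (by omega)]
      rw [this]; simp
  -- An eigenfunction is determined by its value at `0`, so that `κ z` is a multiple of `z`.
  have hu : ∀ i ≤ n + 1, κ i * z i = -B * z i := by
    have hdiff : IsPathEigen n ρ (fun i => κ i * z i + B * z i) :=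
      ⟨by rw [hw.boundary, hz.boundary], fun i hi => by
        have h1 := hw.eq i hi
        have h2 := hz.eq i hi
        linear_combination h1 + B * h2⟩
    intro i hi
    have := hdiff.eq_zero (by simp only [hκ1 0 hm0]; ring) hi
    linarith
  have h1 := hu t (by omega)
  have h2 := hu (t + 1) (by omega)
  have h3 := hu (t + 2) (by omega)
  rw [hκ2 t (by omega) le_rfl] at h1
  have hAB : A = -B := mul_right_cancel₀ hzt.ne h1
  rw [hκ3 _ (by omega), ← hAB, zero_mul, eq_comm, mul_eq_zero, or_iff_right hA.ne'] at h2 h3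
  have h4 := hz.eq (t + 1) hjn
  rw [Nat.add_sub_cancel, h2, h3] at h4
  linarith

lemma partial_sum_pos {i : ℕ} (hi : i < n) : 0 < ∑ j ∈ Finset.range (i + 1), ρ j * z j := by
  obtain ⟨m, hm0, hmn, hpos, hzm, hneg⟩ := hz.exists_sign_change hμ hρ hmin h0
  have hρ0 : ∀ i ≤ n, 0 < ρ i := fun i hi => hμ.trans_le (hρ i hi)
  rcases Nat.lt_or_ge i m with h | h
  · exact Finset.sum_pos (fun j hj => by
      rw [Finset.mem_range] at hj
      exact mul_pos (hρ0 j (by omega)) (hpos j (by omega))) ⟨0, by simp⟩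
  · have h1 := hz.sum_eq_zero
    rw [← Finset.sum_range_add_sum_Ico _ (show i + 1 ≤ n + 1 by omega)] at h1
    have h2 : ∑ j ∈ Finset.Ico (i + 1) (n + 1), ρ j * z j < 0 := by
      refine Finset.sum_neg (fun j hj => ?_) ⟨n, by simp; omega⟩
      rw [Finset.mem_Ico] at hj
      exact mul_neg_of_pos_of_neg (hρ0 j (by omega)) (hneg j (by omega) (by omega))
    linarith

lemma lt_of_lt {i j : ℕ} (hij : i < j) (hj : j ≤ n) : z j < z i := by
  induction j with
  | zero => omega
  | succ j ih =>
    have h1 := hz.partial_sum_pos hμ hρ hmin h0 (i := j) (by omega)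
    rw [← hz.flux (by omega)] at h1
    rcases Nat.lt_or_ge i j with h | h
    · linarith [ih h (by omega)]
    · obtain rfl : i = j := by omega
      linarith

lemma last_neg : z n < 0 := by
  obtain ⟨m, hm0, hmn, -⟩ := hz.exists_sign_change hμ hρ hmin h0
  obtain ⟨k, rfl⟩ : ∃ k, n = k + 1 := ⟨n - 1, by omega⟩
  have h1 := hz.partial_sum_pos hμ hρ hmin h0 (i := k) (by omega)
  have h2 := hz.sum_eq_zero
  rw [Finset.sum_range_succ] at h2
  have h3 : 0 < ρ (k + 1) := hμ.trans_le (hρ _ le_rfl)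
  nlinarith

/-- On a long path the weights cannot all be large. If `z` is positive and decreasing on the first
`s` vertices and nonnegative at the next one, then the flux out of these vertices is at least
`s * μ` times the value at the last of them, and at most this value, so that `s * μ ≤ 1`. The same
holds at the right end, where `z` is negative. -/
lemma mul_le_two : μ * (n - 1 : ℝ) ≤ 2 := by
  obtain ⟨m, hm0, hmn, hpos, hzm, hneg⟩ := hz.exists_sign_change hμ hρ hmin h0
  have hleft : μ * (m - 1 : ℝ) ≤ 1 := by
    obtain ⟨s, rfl⟩ : ∃ s, m = s + 1 := ⟨m - 1, by omega⟩
    cases s with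
    | zero => simp
    | succ s =>
      have h1 := hz.flux (i := s) (by omega)
      have h2 : ∑ _j ∈ Finset.range (s + 1), μ * z s ≤ ∑ j ∈ Finset.range (s + 1), ρ j * z j := by
        refine Finset.sum_le_sum fun j hj => ?_
        rw [Finset.mem_range] at hj
        have h3 : z s ≤ z j := by
          rcases Nat.lt_or_ge j s with h | h
          · exact (hz.lt_of_lt hμ hρ hmin h0 h (by omega)).le
          · rw [show j = s by omega]
        exact mul_le_mul (hρ j (by omega)) h3 (hpos s (by omega)).le
          (hμ.le.trans (hρ j (by omega)))
      rw [Finset.sum_const, Finset.card_range, nsmul_eq_mul] at h2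
      have h4 := hpos (s + 1) (by omega)
      have h5 := hpos s (by omega)
      push_cast at h2 ⊢
      have h6 : (μ * (s + 1) - 1) * z s ≤ 0 := by linarith
      have h7 := nonpos_of_mul_nonpos_left h6 h5
      linarith
  have hright : μ * (n - m : ℝ) ≤ 1 := by
    rcases Nat.eq_or_lt_of_le hmn with h | h
    · simp [h]
    · have h1 := hz.flux (i := m) hmn
      have h1' := hz.sum_eq_zero
      rw [← Finset.sum_range_add_sum_Ico _ (show m + 1 ≤ n + 1 by omega), ← h1] at h1'
      have h2 : ∑ j ∈ Finset.Ico (m + 1) (n + 1), ρ j * z j ≤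
          ∑ _j ∈ Finset.Ico (m + 1) (n + 1), μ * z (m + 1) := by
        refine Finset.sum_le_sum fun j hj => ?_
        rw [Finset.mem_Ico] at hj
        have h3 : z j ≤ z (m + 1) := by
          rcases Nat.lt_or_ge (m + 1) j with h | h
          · exact (hz.lt_of_lt hμ hρ hmin h0 h (by omega)).le
          · rw [show j = m + 1 by omega]
        have h4 := hneg (m + 1) (by omega) (by omega)
        have h5 := hρ j (by omega)
        nlinarith
      rw [Finset.sum_const, Nat.card_Ico, nsmul_eq_mul, Nat.add_sub_add_right,
        Nat.cast_sub hmn] at h2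
      have h4 := hneg (m + 1) (by omega) (by omega)
      have h6 : (μ * (n - m) - 1) * (-z (m + 1)) ≤ 0 := by linarith
      have h7 := nonpos_of_mul_nonpos_left h6 (by linarith)
      linarith
  linarith

end IsPathEigen

end Path

/-! ### The algebraic connectivity -/

section Connectivity

variable {V : Type*} [Fintype V] [DecidableEq V] {G : SimpleGraph V} [DecidableRel G.Adj]

lemma algebraicConnectivity_mem {p q : V} (hpq : G.Adj p q) :
    algebraicConnectivity G ∈ spectrum ℝ (G.lapMatrix ℝ) \ {0} := by
  have hne : G.lapMatrix ℝ ≠ 0 := by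
    intro h
    have h1 : G.lapMatrix ℝ p q = 0 := by rw [h]; rfl
    simp [SimpleGraph.lapMatrix, SimpleGraph.degMatrix, SimpleGraph.adjMatrix_apply, hpq,
      hpq.ne] at h1
  obtain ⟨y, t, ht, hy, hty⟩ := (G.isHermitian_lapMatrix ℝ).exists_eigenvector_of_ne_zero hne
  exact Set.Nonempty.csInf_mem ⟨t, mem_spectrum_of_mulVec_eq hy hty, ht⟩
    ((Matrix.finite_real_spectrum (A := G.lapMatrix ℝ)).subset Set.sdiff_subset)

lemma exists_isFiedlerVector {p q : V} (hpq : G.Adj p q) : ∃ x, IsFiedlerVector G x := by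
  have h := (algebraicConnectivity_mem hpq).1
  rw [← Matrix.spectrum_toLin'] at h
  exact (Module.End.HasEigenvalue.of_mem_spectrum h).exists_hasEigenvector

lemma isFiedlerVector_iff {x : V → ℝ} :
    IsFiedlerVector G x ↔ G.lapMatrix ℝ *ᵥ x = algebraicConnectivity G • x ∧ x ≠ 0 := by
  rw [IsFiedlerVector, Module.End.hasEigenvector_iff, Module.End.mem_eigenspace_iff,
    Matrix.toLin'_apply]

lemma algebraicConnectivity_pos {p q : V} (hpq : G.Adj p q) : 0 < algebraicConnectivity G := by
  obtain ⟨x, hx⟩ := exists_isFiedlerVector hpq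
  obtain ⟨h1, h2⟩ := isFiedlerVector_iff.1 hx
  refine lt_of_le_of_ne ?_ (Ne.symm (algebraicConnectivity_mem hpq).2)
  have h3 := (SimpleGraph.posSemidef_lapMatrix ℝ G).dotProduct_mulVec_nonneg x
  rw [h1, dotProduct_smul, star_trivial, smul_eq_mul] at h3
  have h4 : 0 ≤ x ⬝ᵥ x := Finset.sum_nonneg fun u _ => mul_self_nonneg _
  have h5 : x ⬝ᵥ x ≠ 0 := fun h => h2 (dotProduct_self_eq_zero.1 h)
  exact nonneg_of_mul_nonneg_left h3 (lt_of_le_of_ne h4 h5.symm)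

/-- The variational characterization of the algebraic connectivity: among the vectors with entry
sum zero, only eigenvectors have a Rayleigh quotient that does not exceed it. -/
lemma mulVec_eq_of_energy_le (hG : G.Connected) {y : V → ℝ} (hy : ∑ p, y p = 0)
    (hle : y ⬝ᵥ (G.lapMatrix ℝ *ᵥ y) ≤ algebraicConnectivity G * (y ⬝ᵥ y)) :
    G.lapMatrix ℝ *ᵥ y = algebraicConnectivity G • y := by
  set μ := algebraicConnectivity G
  have := hG.nonempty
  have hN : (Fintype.card V : ℝ) ≠ 0 := by exact_mod_cast Fintype.card_ne_zero
  -- The rank one term moves the constant vectors from the eigenvalue `-μ` to the eigenvalue `0`.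
  set M : Matrix V V ℝ := G.lapMatrix ℝ - μ • (1 : Matrix V V ℝ) +
    Matrix.of fun _ _ => μ / Fintype.card V with hM
  have hMv : ∀ y : V → ℝ, M *ᵥ y =
      G.lapMatrix ℝ *ᵥ y - μ • y + fun _ => μ / Fintype.card V * ∑ p, y p := by
    intro y
    rw [hM, Matrix.add_mulVec, Matrix.sub_mulVec, Matrix.smul_mulVec, Matrix.one_mulVec]
    congr 1
    funext p
    simp [Matrix.mulVec, dotProduct, Finset.mul_sum]
  have hps : M.PosSemidef := by
    refine posSemidef_of_eigenvalue_nonneg (((G.isHermitian_lapMatrix ℝ).sub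
      (Matrix.isHermitian_one.smul (IsSelfAdjoint.all _))).add ?_) fun t x hx htx => ?_
    · ext p q; simp
    · by_contra ht
      push Not at ht
      rw [hMv] at htx
      have hsum : ∑ p, x p = 0 := by
        have h1 := congrArg (fun f : V → ℝ => ∑ p, f p) htx
        simp only [Pi.add_apply, Pi.sub_apply, Pi.smul_apply, smul_eq_mul,
          Finset.sum_add_distrib, Finset.sum_sub_distrib, sum_lapMatrix_mulVec, ← Finset.mul_sum,
          Finset.sum_const, Finset.card_univ, nsmul_eq_mul] at h1
        have h2 : t * ∑ p, x p = 0 := by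
          rw [← h1]; field_simp; ring
        exact (mul_eq_zero.1 h2).resolve_left ht.ne
      have hLx : G.lapMatrix ℝ *ᵥ x = (t + μ) • x := by
        rw [hsum, mul_zero] at htx
        rw [add_smul, ← htx]
        funext p
        simp
      by_cases h0 : t + μ = 0
      · rw [h0, zero_smul] at hLx
        apply hx
        funext p
        have h1 : ∑ q, x q = ∑ _q : V, x p :=
          Finset.sum_congr rfl fun q _ => eq_of_lapMatrix_mulVec_eq_zero hG hLx q p
        rw [hsum, Finset.sum_const, Finset.card_univ, nsmul_eq_mul] at h1
        exact (mul_eq_zero.1 h1.symm).resolve_left hN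
      · have : μ ≤ t + μ := csInf_le
          ((Matrix.finite_real_spectrum (A := G.lapMatrix ℝ)).subset Set.sdiff_subset).bddBelow
          ⟨mem_spectrum_of_mulVec_eq hx hLx, h0⟩
        linarith
  have h1 : M *ᵥ y = G.lapMatrix ℝ *ᵥ y - μ • y := by
    rw [hMv, hy, mul_zero]
    funext p
    simp
  have h2 := hps.dotProduct_mulVec_nonneg y
  have h3 := (hps.dotProduct_mulVec_zero_iff y).1 (le_antisymm ?_ h2)
  · rw [h1] at h3
    exact sub_eq_zero.1 h3
  · rw [h1, star_trivial, dotProduct_sub, dotProduct_smul, smul_eq_mul]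
    linarith

end Connectivity

/-! ### The Laplacian of a caterpillar -/

section Caterpillar

lemma sum_pathGraph_adj {n : ℕ} {w : ℕ → ℝ} (hw : w (n + 1) = w n) (i : Fin (n + 1))
    [DecidablePred ((SimpleGraph.pathGraph (n + 1)).Adj i)] :
    (∑ j : Fin (n + 1), if (SimpleGraph.pathGraph (n + 1)).Adj i j then w i - w j else 0) =
      2 * w i - w (i + 1) - w (i - 1) := by
  have h1 : ∀ j : Fin (n + 1),
      (if (SimpleGraph.pathGraph (n + 1)).Adj i j then w i - w j else 0) =
      (if (i : ℕ) + 1 = j then w i - w j else 0) + if (j : ℕ) + 1 = i then w i - w j else 0 := by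
    intro j
    simp only [SimpleGraph.pathGraph_adj]
    by_cases ha : (i : ℕ) + 1 = j
    · simp [ha, show ¬ ((j : ℕ) + 1 = i) by omega]
    · simp [ha]
  simp only [h1, Finset.sum_add_distrib]
  have h2 : (∑ j : Fin (n + 1), if (i : ℕ) + 1 = j then w i - w j else 0) = w i - w (i + 1) := by
    by_cases hi : (i : ℕ) < n
    · rw [Finset.sum_eq_single ⟨i + 1, by omega⟩]
      · simp
      · intro b _ hb
        rw [if_neg]
        intro h
        exact hb (Fin.ext h.symm)
      · simp
    · have hin : (i : ℕ) = n := by omega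
      rw [Finset.sum_eq_zero, hin, hw, sub_self]
      intro j _
      rw [if_neg]
      omega
  have h3 : (∑ j : Fin (n + 1), if (j : ℕ) + 1 = i then w i - w j else 0) = w i - w (i - 1) := by
    by_cases hi : 0 < (i : ℕ)
    · rw [Finset.sum_eq_single ⟨i - 1, by omega⟩]
      · simp [show (i : ℕ) - 1 + 1 = i by omega]
      · intro b _ hb
        rw [if_neg]
        intro h
        exact hb (Fin.ext (by simp; omega))
      · simp
    · have hin : (i : ℕ) = 0 := by omega
      rw [Finset.sum_eq_zero, hin, Nat.zero_sub, sub_self]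
      intro j _
      rw [if_neg]
      omega
  rw [h2, h3]
  ring

variable {V : Type*} {S : SimpleGraph V} {v₀ : V} {n : ℕ} {m : Fin (n + 1) → ℕ}

lemma caterpillar_connected (hS : S.Connected) : (caterpillar S v₀ n m).Connected := by
  classical
  have hpath : ∀ i i' : Fin (n + 1),
      (caterpillar S v₀ n m).Reachable (Sum.inl i) (Sum.inl i') := fun i i' =>
    ((SimpleGraph.pathGraph_connected n) i i').map
      (⟨Sum.inl, fun h => h⟩ : SimpleGraph.pathGraph (n + 1) →g caterpillar S v₀ n m)
  have hcopy : ∀ (i : Fin (n + 1)) (j : Fin (m i)) (u : {u : V // u ≠ v₀}),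
      (caterpillar S v₀ n m).Reachable (Sum.inr ⟨i, j, u⟩) (Sum.inl i) := by
    intro i j u
    let f : S →g caterpillar S v₀ n m :=
      { toFun := fun w => if hw : w = v₀ then Sum.inl i else Sum.inr ⟨i, j, ⟨w, hw⟩⟩
        map_rel' := by
          intro a b hab
          by_cases ha : a = v₀
          · by_cases hb : b = v₀
            · exact absurd (ha.trans hb.symm) hab.ne
            · simp only [ha, hb, dif_pos, dif_neg, not_false_eq_true]
              exact ⟨rfl, ha ▸ hab⟩
          · by_cases hb : b = v₀
            · simp only [ha, hb, dif_pos, dif_neg, not_false_eq_true]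
              exact ⟨rfl, hb ▸ hab.symm⟩
            · simp only [ha, hb, dif_neg, not_false_eq_true]
              exact ⟨rfl, rfl, hab⟩ }
    have h := (hS u.1 v₀).map f
    have h1 : f u.1 = Sum.inr ⟨i, j, u⟩ := dif_neg u.2
    have h2 : f v₀ = Sum.inl i := dif_pos rfl
    rwa [h1, h2] at h
  have hroot : ∀ p, (caterpillar S v₀ n m).Reachable p (Sum.inl 0) := by
    rintro (i | ⟨i, j, u⟩)
    · exact hpath i 0
    · exact (hcopy i j u).trans (hpath i 0)
  exact ⟨fun p q => (hroot p).trans (hroot q).symm⟩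

variable [DecidableEq V]

/-- The restriction of a function on the caterpillar to the `j`-th copy of `S` at the `i`-th vertex
of the central path. -/
def restrict (x : Vert v₀ n m → ℝ) (i : Fin (n + 1)) (j : Fin (m i)) (u : V) : ℝ :=
  if hu : u = v₀ then x (Sum.inl i) else x (Sum.inr ⟨i, j, ⟨u, hu⟩⟩)

lemma restrict_root (x : Vert v₀ n m → ℝ) (i : Fin (n + 1)) (j : Fin (m i)) :
    restrict x i j v₀ = x (Sum.inl i) := dif_pos rfl

lemma restrict_coe (x : Vert v₀ n m → ℝ) (i : Fin (n + 1)) (j : Fin (m i))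
    (u : {u : V // u ≠ v₀}) : restrict x i j u.1 = x (Sum.inr ⟨i, j, u⟩) := dif_neg u.2

variable [Fintype V] [DecidableRel S.Adj]

lemma lapMatrix_mulVec_inr (x : Vert v₀ n m → ℝ) (i : Fin (n + 1)) (j : Fin (m i))
    (u : {u : V // u ≠ v₀}) :
    ((caterpillar S v₀ n m).lapMatrix ℝ *ᵥ x) (Sum.inr ⟨i, j, u⟩) =
      (S.lapMatrix ℝ *ᵥ restrict x i j) u.1 := by
  have hl : ∀ i', (caterpillar S v₀ n m).Adj (Sum.inr ⟨i, j, u⟩) (Sum.inl i') ↔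
      i' = i ∧ S.Adj v₀ u.1 := fun _ => Iff.rfl
  have hr : ∀ i' j' u', (caterpillar S v₀ n m).Adj (Sum.inr ⟨i, j, u⟩) (Sum.inr ⟨i', j', u'⟩) ↔
      i = i' ∧ (j : ℕ) = j' ∧ S.Adj u.1 u'.1 := fun _ _ _ => Iff.rfl
  rw [lapMatrix_mulVec_eq_sum, lapMatrix_mulVec_eq_sum, Fintype.sum_sum_type, Fintype.sum_sigma,
    Fintype.sum_eq_add_sum_subtype_ne _ v₀]
  congr 1
  · rw [Finset.sum_eq_single i]
    · simp only [hl, true_and, restrict_root, restrict_coe, S.adj_comm v₀ u.1]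
    · intro b _ hb
      rw [if_neg]
      exact fun h => hb h.1
    · simp
  · rw [Finset.sum_eq_single i]
    · rw [Fintype.sum_prod_type, Finset.sum_eq_single j]
      · simp only [hr, true_and, restrict_coe]
      · intro b _ hb
        refine Finset.sum_eq_zero fun u' _ => if_neg fun h => hb ?_
        exact Fin.ext h.2.1.symm
      · simp
    · intro b _ hb
      refine Finset.sum_eq_zero fun c _ => if_neg fun h => hb ?_
      exact h.1.symm
    · simp

lemma lapMatrix_mulVec_inl {x : Vert v₀ n m → ℝ} {w : ℕ → ℝ} (hw : w (n + 1) = w n)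
    (hxw : ∀ i : Fin (n + 1), x (Sum.inl i) = w i) (i : Fin (n + 1)) :
    ((caterpillar S v₀ n m).lapMatrix ℝ *ᵥ x) (Sum.inl i) =
      2 * w i - w (i + 1) - w (i - 1) +
        ∑ j, (S.lapMatrix ℝ *ᵥ restrict x i j) v₀ := by
  classical
  have hl : ∀ i', (caterpillar S v₀ n m).Adj (Sum.inl i) (Sum.inl i') ↔
      (SimpleGraph.pathGraph (n + 1)).Adj i i' := fun _ => Iff.rfl
  have hr : ∀ i' j' u', (caterpillar S v₀ n m).Adj (Sum.inl i) (Sum.inr ⟨i', j', u'⟩) ↔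
      i = i' ∧ S.Adj v₀ u'.1 := fun _ _ _ => Iff.rfl
  rw [lapMatrix_mulVec_eq_sum, Fintype.sum_sum_type, Fintype.sum_sigma, ← sum_pathGraph_adj hw]
  congr 1
  · simp only [hl, hxw]
  · rw [Finset.sum_eq_single i]
    · rw [Fintype.sum_prod_type]
      refine Finset.sum_congr rfl fun j _ => ?_
      rw [lapMatrix_mulVec_eq_sum, Fintype.sum_eq_add_sum_subtype_ne _ v₀]
      simp only [hr, true_and, restrict_coe, restrict_root, SimpleGraph.irrefl, if_false, zero_add]
    · intro b _ hb
      refine Finset.sum_eq_zero fun c _ => if_neg fun h => hb ?_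
      exact h.1.symm
    · simp

end Caterpillar

/-! ### Reduction of the caterpillar to its central path -/

section Reduction

variable {V : Type*} {S : SimpleGraph V} {v₀ : V} {n : ℕ} {m : Fin (n + 1) → ℕ}

/-- The function on the caterpillar that equals `w` on the central path and a multiple of `h` on
every copy of `S`. -/
def extend (h : V → ℝ) (w : ℕ → ℝ) : Vert v₀ n m → ℝ
  | Sum.inl i => w i
  | Sum.inr b => w b.1 * h b.2.2.1

variable [DecidableEq V]

lemma restrict_extend {h : V → ℝ} (hr : h v₀ = 1) (w : ℕ → ℝ) (i : Fin (n + 1)) (j : Fin (m i)) :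
    restrict (extend h w : Vert v₀ n m → ℝ) i j = w i • h := by
  funext u
  by_cases hu : u = v₀
  · subst hu
    rw [restrict_root, Pi.smul_apply, hr, smul_eq_mul, mul_one, extend]
  · rw [restrict, dif_neg hu, extend, Pi.smul_apply, smul_eq_mul]

variable [Fintype V] [DecidableRel S.Adj]

variable (S v₀) in
/-- The weight of the `k`-th vertex of the central path: the eigenvalue parameter `μ` plus the flux
of the profile `h` into the attached copies of `S`. -/
noncomputable def pathWeight (μ : ℝ) (h : V → ℝ) (m : Fin (n + 1) → ℕ) (k : ℕ) : ℝ :=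
  if hk : k < n + 1 then μ - m ⟨k, hk⟩ * (S.lapMatrix ℝ *ᵥ h) v₀ else μ

lemma pathWeight_coe (μ : ℝ) (h : V → ℝ) (m : Fin (n + 1) → ℕ) (i : Fin (n + 1)) :
    pathWeight S v₀ μ h m i = μ - m i * (S.lapMatrix ℝ *ᵥ h) v₀ := dif_pos i.2

variable {μ : ℝ} {h : V → ℝ} (hh : IsProfile S v₀ μ h)

lemma IsProfile.le_pathWeight (hh : IsProfile S v₀ μ h)
    (hS : S.IsTree) (hμ : μ < lambdaMin (reducedLaplacian S v₀)) (hμ0 : 0 < μ)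
    (m : Fin (n + 1) → ℕ) (k : ℕ) : μ ≤ pathWeight S v₀ μ h m k := by
  have h1 : (S.lapMatrix ℝ *ᵥ h) v₀ ≤ 0 := by
    have h2 := sum_lapMatrix_mulVec S h
    rw [← Finset.add_sum_erase _ _ (Finset.mem_univ v₀)] at h2
    have h3 : 0 ≤ ∑ u ∈ Finset.univ.erase v₀, (S.lapMatrix ℝ *ᵥ h) u :=
      Finset.sum_nonneg fun u hu =>
        (hh.lapMatrix_pos hS hμ hμ0 u (Finset.ne_of_mem_erase hu)).le
    linarith
  unfold pathWeight
  split_ifs with hk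
  · have : (m ⟨k, hk⟩ : ℝ) * (S.lapMatrix ℝ *ᵥ h) v₀ ≤ 0 :=
      mul_nonpos_of_nonneg_of_nonpos (Nat.cast_nonneg _) h1
    linarith
  · exact le_rfl

include hh

lemma lapMatrix_mulVec_extend_inr (w : ℕ → ℝ) (i : Fin (n + 1)) (j : Fin (m i))
    (u : {u : V // u ≠ v₀}) :
    ((caterpillar S v₀ n m).lapMatrix ℝ *ᵥ extend h w) (Sum.inr ⟨i, j, u⟩) =
      μ * extend h w (Sum.inr ⟨i, j, u⟩ : Vert v₀ n m) := by
  rw [lapMatrix_mulVec_inr, restrict_extend hh.root, Matrix.mulVec_smul, Pi.smul_apply,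
    hh.eq u.1 u.2, smul_eq_mul, extend]
  ring

lemma lapMatrix_mulVec_extend_inl {w : ℕ → ℝ} (hw : w (n + 1) = w n) (i : Fin (n + 1)) :
    ((caterpillar S v₀ n m).lapMatrix ℝ *ᵥ extend h w) (Sum.inl i) =
      μ * extend h w (Sum.inl i : Vert v₀ n m) +
        (2 * w i - w (i + 1) - w (i - 1) - pathWeight S v₀ μ h m i * w i) := by
  rw [lapMatrix_mulVec_inl hw (fun _ => rfl), pathWeight_coe]
  simp only [restrict_extend hh.root, Matrix.mulVec_smul, Pi.smul_apply, smul_eq_mul,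
    Finset.sum_const, Finset.card_univ, Fintype.card_fin, nsmul_eq_mul, extend]
  ring

/-- Every eigenvector of the caterpillar is the extension of an eigenfunction on the path. -/
lemma exists_isPathEigen (hμ : μ < lambdaMin (reducedLaplacian S v₀)) {x : Vert v₀ n m → ℝ}
    (hx : (caterpillar S v₀ n m).lapMatrix ℝ *ᵥ x = μ • x) :
    ∃ z, IsPathEigen n (pathWeight S v₀ μ h m) z ∧ x = extend h z := by
  set z : ℕ → ℝ := fun k => x (Sum.inl ⟨min k n, by omega⟩) with hz
  have hzb : z (n + 1) = z n := by
    simp only [hz]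
    congr 3
    omega
  have hzi : ∀ i : Fin (n + 1), x (Sum.inl i) = z i := fun i => by
    simp only [hz]
    congr 2
    exact Fin.ext (by simp; omega)
  have hext : x = extend h z := by
    funext p
    rcases p with i | ⟨i, j, u⟩
    · exact hzi i
    · rw [← restrict_coe x, hh.eq_mul hμ (f := restrict x i j), restrict_root, hzi, extend]
      intro u' hu'
      have h1 := lapMatrix_mulVec_inr (S := S) x i j ⟨u', hu'⟩
      rw [← h1, hx, Pi.smul_apply, smul_eq_mul, ← restrict_coe x]
  refine ⟨z, ⟨hzb, fun i hi => ?_⟩, hext⟩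
  have h1 := lapMatrix_mulVec_extend_inl hh (m := m) hzb ⟨i, by omega⟩
  rw [← hext, hx, Pi.smul_apply, smul_eq_mul] at h1
  simp only at h1
  linarith

/-- The variational characterization of the algebraic connectivity of a caterpillar, transferred to
the central path. -/
lemma isPathEigen_of_energy_nonpos (hS : S.Connected)
    (hμ : μ = algebraicConnectivity (caterpillar S v₀ n m)) (hμ0 : 0 < μ) {w : ℕ → ℝ}
    (hw : w (n + 1) = w n)
    (hsum : ∑ i ∈ Finset.range (n + 1), pathWeight S v₀ μ h m i * w i = 0)
    (hle : ∑ i ∈ Finset.range (n + 1), w i * (2 * w i - w (i + 1) - w (i - 1) -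
      pathWeight S v₀ μ h m i * w i) ≤ 0) :
    IsPathEigen n (pathWeight S v₀ μ h m) w := by
  set y : Vert v₀ n m → ℝ := extend h w with hy
  set d : ℕ → ℝ := fun i => 2 * w i - w (i + 1) - w (i - 1) - pathWeight S v₀ μ h m i * w i with hd
  set L := (caterpillar S v₀ n m).lapMatrix ℝ with hL
  have hinl : ∀ i : Fin (n + 1), (L *ᵥ y) (Sum.inl i) - μ * y (Sum.inl i) = d i := fun i => by
    rw [hL, hy, lapMatrix_mulVec_extend_inl hh hw]; ring
  have hinr : ∀ b, (L *ᵥ y) (Sum.inr b) - μ * y (Sum.inr b) = 0 := fun b => by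
    obtain ⟨i, j, u⟩ := b
    rw [hL, hy, lapMatrix_mulVec_extend_inr hh, sub_self]
  have hsub : ∀ f : Vert v₀ n m → ℝ, ∑ p, f p * ((L *ᵥ y) p - μ * y p) =
      ∑ i : Fin (n + 1), f (Sum.inl i) * d i := fun f => by
    rw [Fintype.sum_sum_type]
    simp only [hinl, hinr, mul_zero, Finset.sum_const_zero, add_zero]
  have hd0 : ∑ i : Fin (n + 1), d i = 0 := by
    classical
    have h1 : ∑ i : Fin (n + 1), ∑ j : Fin (n + 1),
        (if (SimpleGraph.pathGraph (n + 1)).Adj i j then w i - w j else 0) = 0 := by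
      have h2 := sum_lapMatrix_mulVec (SimpleGraph.pathGraph (n + 1)) (fun i => w i)
      simpa only [lapMatrix_mulVec_eq_sum] using h2
    simp only [sum_pathGraph_adj hw] at h1
    rw [Finset.sum_range] at hsum
    simp only [hd, Finset.sum_sub_distrib] at h1 ⊢
    rw [h1, hsum, sub_self]
  have hysum : ∑ p, y p = 0 := by
    have h1 := hsub fun _ => 1
    simp only [one_mul, Finset.sum_sub_distrib, hL, sum_lapMatrix_mulVec, ← Finset.mul_sum, hd0,
      zero_sub, neg_eq_zero, mul_eq_zero, hμ0.ne', false_or] at h1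
    exact h1
  have hen : y ⬝ᵥ (L *ᵥ y) ≤ μ * (y ⬝ᵥ y) := by
    have h1 := hsub y
    have h2 : ∑ i : Fin (n + 1), y (Sum.inl i) * d i ≤ 0 := by
      rw [Finset.sum_range] at hle
      exact hle
    rw [← h1] at h2
    simp only [mul_sub, Finset.sum_sub_distrib] at h2
    have h3 : ∑ p, y p * (μ * y p) = μ * (y ⬝ᵥ y) := by
      rw [dotProduct, Finset.mul_sum]
      exact Finset.sum_congr rfl fun p _ => by ring
    rw [h3] at h2
    change y ⬝ᵥ (L *ᵥ y) - _ ≤ 0 at h2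
    linarith
  rw [hμ] at hen
  have heig := mulVec_eq_of_energy_le (caterpillar_connected hS) hysum hen
  rw [← hμ] at heig
  refine ⟨hw, fun i hi => ?_⟩
  have h1 := hinl ⟨i, by omega⟩
  rw [hL, heig, Pi.smul_apply, smul_eq_mul, sub_self] at h1
  simp only [hd] at h1
  linarith

end Reduction

/-! ### Extremal entries of Fiedler vectors of caterpillars -/

section Extremal

variable {V : Type*} {v₀ : V} {n : ℕ} {m : Fin (n + 1) → ℕ}

lemma InCopyAt.imp {i : Fin (n + 1)} {P Q : V → Prop} (hPQ : ∀ u, u ≠ v₀ → P u → Q u)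
    {p : Vert v₀ n m} (hp : InCopyAt i P p) : InCopyAt i Q p := by
  obtain ⟨j, u, hu, rfl⟩ := hp
  exact ⟨j, u, hPQ u.1 u.2 hu, rfl⟩

lemma maxAt_neg {W : Type*} {x : W → ℝ} {p : W} : MaxAt (-x) p ↔ MinAt x p := by
  simp [MaxAt, MinAt]

/-- If the values on the central path have a strict and positive maximum at a vertex to which a copy
of `S` is attached, then the maxima of the extension lie at the maxima of the profile in the copies
at this vertex. -/
lemma maxAt_extend_iff [Finite V] (hV : ∃ u, u ≠ v₀) {h : V → ℝ} (hr : h v₀ = 1)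
    (h1 : ∀ u, u ≠ v₀ → 1 < h u)
    {w : ℕ → ℝ} {i₀ : Fin (n + 1)} (hm : 1 ≤ m i₀) (hpos : 0 < w i₀)
    (hmax : ∀ i : Fin (n + 1), i ≠ i₀ → w i < w i₀) (p : Vert v₀ n m) :
    MaxAt (extend h w : Vert v₀ n m → ℝ) p ↔ InCopyAt i₀ (fun u => ∀ u', h u' ≤ h u) p := by
  have : Nonempty V := ⟨v₀⟩
  obtain ⟨a, ha⟩ := Finite.exists_max h
  obtain ⟨b, hb⟩ := hV
  have ha1 : 1 < h a := (h1 b hb).trans_le (ha b)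
  have hav : a ≠ v₀ := by rintro rfl; linarith
  have hh0 : ∀ u, 0 < h u := fun u => by
    by_cases hu : u = v₀
    · rw [hu, hr]; exact one_pos
    · exact one_pos.trans (h1 u hu)
  have hle : ∀ i : Fin (n + 1), w i ≤ w i₀ := fun i => by
    by_cases hi : i = i₀
    · rw [hi]
    · exact (hmax i hi).le
  have hbound : ∀ q : Vert v₀ n m, extend h w q ≤ w i₀ * h a := by
    rintro (i | ⟨i, j, u⟩)
    · have := hle i
      simp only [extend]
      nlinarith
    · simp only [extend]
      calc w i * h u.1 ≤ w i₀ * h u.1 := mul_le_mul_of_nonneg_right (hle i) (hh0 _).le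
        _ ≤ w i₀ * h a := mul_le_mul_of_nonneg_left (ha _) hpos.le
  have hatt : extend h w (Sum.inr ⟨i₀, ⟨0, hm⟩, ⟨a, hav⟩⟩ : Vert v₀ n m) = w i₀ * h a := rfl
  constructor
  · intro hp
    have h2 := hp (Sum.inr ⟨i₀, ⟨0, hm⟩, ⟨a, hav⟩⟩)
    rw [hatt] at h2
    rcases p with i | ⟨i, j, u⟩
    · exfalso
      have := hle i
      simp only [extend] at h2
      nlinarith
    · simp only [extend] at h2
      by_cases hi : i = i₀
      · subst hi
        refine ⟨j, u, fun u' => (ha u').trans ?_, rfl⟩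
        exact le_of_mul_le_mul_left h2 hpos
      · exfalso
        have h3 : w i * h u.1 < w i₀ * h u.1 := mul_lt_mul_of_pos_right (hmax i hi) (hh0 _)
        have h4 : w i₀ * h u.1 ≤ w i₀ * h a := mul_le_mul_of_nonneg_left (ha _) hpos.le
        linarith
  · rintro ⟨j, u, hu, rfl⟩ q
    refine (hbound q).trans ?_
    exact mul_le_mul_of_nonneg_left (hu a) hpos.le

variable [Fintype V] [DecidableEq V] {S : SimpleGraph V} [DecidableRel S.Adj]

omit [Fintype V] [DecidableEq V] [DecidableRel S.Adj] in
lemma exists_caterpillar_adj {a : V} (ha : S.Adj v₀ a) (hm : 1 ≤ m 0) :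
    (caterpillar S v₀ n m).Adj (Sum.inl 0) (Sum.inr ⟨0, ⟨0, hm⟩, ⟨a, ha.ne'⟩⟩) :=
  ⟨rfl, ha⟩

variable {μ : ℝ} {h : V → ℝ} (hS : S.IsTree) {a : V} (ha : S.Adj v₀ a)
  (hm0 : 1 ≤ m 0) (hmn : 1 ≤ m (Fin.last n))
  (hμ : μ = algebraicConnectivity (caterpillar S v₀ n m))
  (hlt : μ < lambdaMin (reducedLaplacian S v₀)) (hh : IsProfile S v₀ μ h)
  {x : Vert v₀ n m → ℝ} (hx : IsFiedlerVector (caterpillar S v₀ n m) x)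

include ha hm0 hμ in
omit [DecidableRel S.Adj] in
lemma pos_of_eq_algebraicConnectivity : 0 < μ := by
  rw [hμ]
  exact algebraicConnectivity_pos (exists_caterpillar_adj ha hm0)

include hμ hlt hh hx in
lemma fiedler_inl_zero_ne : x (Sum.inl 0) ≠ 0 := by
  obtain ⟨h1, h2⟩ := isFiedlerVector_iff.1 hx
  rw [← hμ] at h1
  obtain ⟨z, hz, rfl⟩ := exists_isPathEigen hh hlt h1
  intro h0
  apply h2
  funext p
  rcases p with i | ⟨i, j, u⟩
  · exact hz.eq_zero h0 (by omega)
  · simp only [extend, hz.eq_zero h0 (show (i : ℕ) ≤ n + 1 by omega), zero_mul, Pi.zero_apply]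

include hS ha hm0 hmn hμ hlt hh hx in
/-- A Fiedler vector that is positive at the first vertex of the central path has its maxima at the
maxima of the profile in the copies at this vertex, and its minima at those in the copies at the
last vertex. A long central path forces a small algebraic connectivity. -/
lemma extremal_of_pos (hpos : 0 < x (Sum.inl 0)) :
    (∀ p, MaxAt x p ↔ InCopyAt 0 (fun u => ∀ u', h u' ≤ h u) p) ∧
      (∀ p, MinAt x p ↔ InCopyAt (Fin.last n) (fun u => ∀ u', h u' ≤ h u) p) ∧
      μ * (n - 1 : ℝ) ≤ 2 := by
  have hμ0 := pos_of_eq_algebraicConnectivity ha hm0 hμ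
  obtain ⟨h1, h2⟩ := isFiedlerVector_iff.1 hx
  rw [← hμ] at h1
  obtain ⟨z, hz, rfl⟩ := exists_isPathEigen hh hlt h1
  have hρ : ∀ i ≤ n, μ ≤ pathWeight S v₀ μ h m i := fun i _ => hh.le_pathWeight hS hlt hμ0 m i
  have hmin := fun w hw hsum hle => isPathEigen_of_energy_nonpos (w := w) hh hS.connected hμ hμ0
    hw hsum hle
  have h0 : 0 < z 0 := hpos
  have hone := hh.one_lt hS hlt hμ0
  refine ⟨maxAt_extend_iff ⟨a, ha.ne'⟩ hh.root hone hm0 h0 fun i hi => ?_, fun p => ?_,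
    hz.mul_le_two hμ0 hρ hmin h0⟩
  · exact hz.lt_of_lt hμ0 hρ hmin h0 (Fin.pos_iff_ne_zero.2 hi) (by omega)
  · have hneg : -(extend h z : Vert v₀ n m → ℝ) = extend h (fun i => -z i) := by
      funext q
      rcases q with i | ⟨i, j, u⟩
      · rfl
      · simp [extend]
    rw [← maxAt_neg, hneg]
    refine maxAt_extend_iff ⟨a, ha.ne'⟩ hh.root hone hmn ?_ (fun i hi => ?_) p
    · simpa using hz.last_neg hμ0 hρ hmin h0
    · have hi' : (i : ℕ) < n := by
        have h3 : (i : ℕ) ≠ n := fun h => hi (Fin.ext h)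
        omega
      simpa using hz.lt_of_lt hμ0 hρ hmin h0 hi' le_rfl

include hS ha hm0 hmn hμ hlt hh hx in
/-- The extremal entries of a Fiedler vector lie at the maxima of the profile in the copies at the
two ends of the central path. -/
lemma extremal_fiedler :
    (((∀ p, MaxAt x p ↔ InCopyAt 0 (fun u => ∀ u', h u' ≤ h u) p) ∧
      (∀ p, MinAt x p ↔ InCopyAt (Fin.last n) (fun u => ∀ u', h u' ≤ h u) p)) ∨
    ((∀ p, MinAt x p ↔ InCopyAt 0 (fun u => ∀ u', h u' ≤ h u) p) ∧
      (∀ p, MaxAt x p ↔ InCopyAt (Fin.last n) (fun u => ∀ u', h u' ≤ h u) p))) ∧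
      μ * (n - 1 : ℝ) ≤ 2 := by
  rcases lt_or_gt_of_ne (fiedler_inl_zero_ne hμ hlt hh hx) with h0 | h0
  · have hx' : IsFiedlerVector (caterpillar S v₀ n m) (-x) := by
      rw [isFiedlerVector_iff] at hx ⊢
      exact ⟨by rw [Matrix.mulVec_neg, hx.1, smul_neg], neg_ne_zero.2 hx.2⟩
    obtain ⟨h1, h2, h3⟩ := extremal_of_pos hS ha hm0 hmn hμ hlt hh hx' (by simpa using h0)
    refine ⟨Or.inr ⟨fun p => ?_, fun p => ?_⟩, h3⟩
    · rw [← h1, maxAt_neg]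
    · rw [← h2, ← maxAt_neg, neg_neg]
  · obtain ⟨h1, h2, h3⟩ := extremal_of_pos hS ha hm0 hmn hμ hlt hh hx h0
    exact ⟨Or.inl ⟨h1, h2⟩, h3⟩

include ha hm0 hμ hlt hh in
lemma finrank_eigenspace_eq_one :
    Module.finrank ℝ (Module.End.eigenspace
      (Matrix.toLin' ((caterpillar S v₀ n m).lapMatrix ℝ))
      (algebraicConnectivity (caterpillar S v₀ n m))) = 1 := by
  obtain ⟨x, hx⟩ := exists_isFiedlerVector (exists_caterpillar_adj (n := n) ha hm0)
  have hx0 := fiedler_inl_zero_ne hμ hlt hh hx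
  refine finrank_eq_one (⟨x, hx.1⟩ : Module.End.eigenspace _ _)
    (fun h => hx.2 (congrArg Subtype.val h)) ?_
  rintro ⟨y, hy⟩
  refine ⟨y (Sum.inl 0) / x (Sum.inl 0), Subtype.ext ?_⟩
  set c := y (Sum.inl 0) / x (Sum.inl 0) with hc
  change c • x = y
  by_contra hne
  have hd : IsFiedlerVector (caterpillar S v₀ n m) (c • x - y) :=
    ⟨Submodule.sub_mem _ (Submodule.smul_mem _ _ hx.1) hy, sub_ne_zero.2 hne⟩
  refine fiedler_inl_zero_ne hμ hlt hh hd ?_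
  simp [hc, hx0]

end Extremal

/-! ### The derivative of `g` -/

section Resolvent

variable {U : Type*} [Fintype U] [DecidableEq U]

lemma hasDerivAt_resolvent {A : Matrix U U ℝ} (hA : A.det ≠ 0) (b e : U → ℝ) :
    HasDerivAt (fun t : ℝ => b ⬝ᵥ ((A - t • (1 : Matrix U U ℝ))⁻¹ *ᵥ e))
      (b ⬝ᵥ (A⁻¹ *ᵥ (A⁻¹ *ᵥ e))) 0 := by
  have hcont : Continuous fun t : ℝ => A - t • (1 : Matrix U U ℝ) := by fun_prop
  have h0 : A - (0 : ℝ) • (1 : Matrix U U ℝ) = A := by simp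
  have hdet : ∀ᶠ t in nhds (0 : ℝ), (A - t • (1 : Matrix U U ℝ)).det ≠ 0 := by
    have h1 : ContinuousAt (fun t : ℝ => (A - t • (1 : Matrix U U ℝ)).det) 0 :=
      hcont.matrix_det.continuousAt
    refine h1.eventually_ne ?_
    rwa [h0]
  have hinv : ContinuousAt (fun t : ℝ => (A - t • (1 : Matrix U U ℝ))⁻¹) 0 := by
    refine ContinuousAt.comp (g := fun M : Matrix U U ℝ => M⁻¹) ?_ hcont.continuousAt
    rw [h0]
    refine continuousAt_matrix_inv A ?_
    rw [Ring.inverse_eq_inv']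
    exact continuousAt_inv₀ hA
  rw [hasDerivAt_iff_tendsto_slope]
  have hlim : Filter.Tendsto
      (fun t : ℝ => b ⬝ᵥ ((A - t • (1 : Matrix U U ℝ))⁻¹ *ᵥ (A⁻¹ *ᵥ e))) (nhdsWithin 0 {0}ᶜ)
      (nhds (b ⬝ᵥ (A⁻¹ *ᵥ (A⁻¹ *ᵥ e)))) := by
    have h1 : ContinuousAt
        (fun t : ℝ => b ⬝ᵥ ((A - t • (1 : Matrix U U ℝ))⁻¹ *ᵥ (A⁻¹ *ᵥ e))) 0 := by
      refine ContinuousAt.comp (g := fun M : Matrix U U ℝ => b ⬝ᵥ (M *ᵥ (A⁻¹ *ᵥ e))) ?_ hinv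
      have : Continuous fun M : Matrix U U ℝ => b ⬝ᵥ (M *ᵥ (A⁻¹ *ᵥ e)) := by fun_prop
      exact this.continuousAt
    have h2 := h1.tendsto
    rw [h0] at h2
    exact h2.mono_left nhdsWithin_le_nhds
  refine hlim.congr' ?_
  filter_upwards [nhdsWithin_le_nhds hdet, self_mem_nhdsWithin] with t ht ht0
  have ht0' : t ≠ 0 := ht0
  -- The resolvent identity for the parameters `t` and `0`.
  have key : (A - t • (1 : Matrix U U ℝ))⁻¹ - A⁻¹ =
      t • ((A - t • (1 : Matrix U U ℝ))⁻¹ * A⁻¹) := by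
    set B := A - t • (1 : Matrix U U ℝ) with hB
    have h1 : B⁻¹ * B = 1 := Matrix.nonsing_inv_mul _ (isUnit_iff_ne_zero.2 ht)
    have h2 : A * A⁻¹ = 1 := Matrix.mul_nonsing_inv _ (isUnit_iff_ne_zero.2 hA)
    calc B⁻¹ - A⁻¹ = B⁻¹ * (A * A⁻¹) - B⁻¹ * B * A⁻¹ := by rw [h1, h2, mul_one, one_mul]
      _ = B⁻¹ * (A - B) * A⁻¹ := by rw [mul_sub B⁻¹ A B, sub_mul, mul_assoc B⁻¹ A]
      _ = t • (B⁻¹ * A⁻¹) := by rw [hB, sub_sub_cancel]; simp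
  rw [slope_def_field, h0, ← dotProduct_sub, ← Matrix.sub_mulVec, key, Matrix.smul_mulVec,
    dotProduct_smul, Matrix.mulVec_mulVec, sub_zero, smul_eq_mul, mul_div_cancel_left₀ _ ht0']

end Resolvent

section Derivative

variable {V : Type*} [Fintype V] [DecidableEq V]

lemma sum_eq_add_add_sum_subtype_ne {v w : V} (hvw : v ≠ w) (f : V → ℝ) :
    ∑ u, f u = f v + f w + ∑ u : {u : V // u ≠ v ∧ u ≠ w}, f u.1 := by
  rw [← Finset.add_sum_erase _ _ (Finset.mem_univ v),
    ← Finset.add_sum_erase _ _ (Finset.mem_erase.2 ⟨hvw.symm, Finset.mem_univ w⟩), add_assoc]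
  congr 2
  exact Finset.sum_subtype _ (by simp [and_comm]) f

variable {S : SimpleGraph V} [DecidableRel S.Adj] {v w : V}

lemma lapMatrix_apply_of_ne {a b : V} (hab : a ≠ b) :
    S.lapMatrix ℝ a b = -if S.Adj b a then 1 else 0 := by
  simp [SimpleGraph.lapMatrix, SimpleGraph.degMatrix, SimpleGraph.adjMatrix_apply, hab,
    S.adj_comm a b]

lemma doublyReducedLaplacian_mulVec (hvw : v ≠ w) (F : V → ℝ)
    (u : {u : V // u ≠ v ∧ u ≠ w}) :
    (doublyReducedLaplacian S v w *ᵥ fun u => F u.1) u =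
      (S.lapMatrix ℝ *ᵥ F) u.1 + F v * nbrVec S v w v u + F w * nbrVec S v w w u := by
  have h : (S.lapMatrix ℝ *ᵥ F) u.1 = S.lapMatrix ℝ u.1 v * F v + S.lapMatrix ℝ u.1 w * F w +
      (doublyReducedLaplacian S v w *ᵥ fun u => F u.1) u :=
    sum_eq_add_add_sum_subtype_ne hvw fun y => S.lapMatrix ℝ u.1 y * F y
  rw [h, lapMatrix_apply_of_ne u.2.1, lapMatrix_apply_of_ne u.2.2, nbrVec, nbrVec]
  ring

lemma det_doublyReducedLaplacian_ne_zero (hS : S.Connected) (hvw : v ≠ w) :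
    (doublyReducedLaplacian S v w).det ≠ 0 := by
  intro h
  obtain ⟨y, hy, hAy⟩ := Matrix.exists_mulVec_eq_zero_iff.2 h
  set F : V → ℝ := fun u => if hu : u ≠ v ∧ u ≠ w then y ⟨u, hu⟩ else 0 with hF
  have hFv : F v = 0 := by simp [hF]
  have hFw : F w = 0 := by simp [hF]
  have hFy : (fun u : {u : V // u ≠ v ∧ u ≠ w} => F u.1) = y := by
    funext u
    simp only [hF, dif_pos u.2]
  have hL : ∀ u, F u * (S.lapMatrix ℝ *ᵥ F) u = 0 := by
    intro u
    by_cases hu : u ≠ v ∧ u ≠ w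
    · have h1 := doublyReducedLaplacian_mulVec (S := S) hvw F ⟨u, hu⟩
      rw [hFy, hAy, hFv, hFw] at h1
      simp only [Pi.zero_apply, zero_mul, add_zero] at h1
      rw [← h1, mul_zero]
    · simp only [hF, dif_neg hu, zero_mul]
  have h0 : S.lapMatrix ℝ *ᵥ F = 0 := by
    rw [← (SimpleGraph.posSemidef_lapMatrix ℝ S).dotProduct_mulVec_zero_iff, star_trivial]
    exact Finset.sum_eq_zero fun u _ => hL u
  apply hy
  funext u
  rw [← hFy]
  exact (eq_of_lapMatrix_mulVec_eq_zero hS h0 u.1 v).trans hFv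

/-- With `R = L_{v,w}(S)⁻¹`, the vector `R e_v` is the harmonic function with boundary values `1` at
`v` and `0` at `w`. Its flux `q` from `v` to `w` is the denominator of `g` at `0`, and also the
numerator, by conservation of flux. Green's identity with the total Gromov product, whose Laplacian
is `1` off `w`, evaluates the sum of the harmonic function and with it the derivative. -/
lemma hasDerivAt_g (hS : S.IsTree) (hv : S.degree v = 1) (hd : 2 ≤ S.dist w v) :
    HasDerivAt (g S v w) (-totalGromov S w v) 0 := by
  have hvw : v ≠ w := by rintro rfl; simp at hd
  have hadj : ¬ S.Adj w v := fun h => by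
    rw [SimpleGraph.dist_eq_one_iff_adj.2 h] at hd
    omega
  set A := doublyReducedLaplacian S v w with hA
  set e := nbrVec S v w v with he
  set f := nbrVec S v w w with hf
  have hdet : A.det ≠ 0 := det_doublyReducedLaplacian_ne_zero hS.connected hvw
  have hAinv : ∀ y, A *ᵥ (A⁻¹ *ᵥ y) = y := fun y => by
    rw [Matrix.mulVec_mulVec, Matrix.mul_nonsing_inv _ (isUnit_iff_ne_zero.2 hdet),
      Matrix.one_mulVec]
  set r := A⁻¹ *ᵥ e with hr
  set F : V → ℝ := fun u => if hu : u ≠ v ∧ u ≠ w then r ⟨u, hu⟩ else if u = v then 1 else 0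
    with hF
  have hFv : F v = 1 := by simp [hF]
  have hFw : F w = 0 := by simp [hF, hvw.symm]
  have hFr : ∀ u : {u : V // u ≠ v ∧ u ≠ w}, F u.1 = r u := fun u => by
    simp only [hF, dif_pos u.2]
  have hLF : ∀ u, u ≠ v → u ≠ w → (S.lapMatrix ℝ *ᵥ F) u = 0 := by
    intro u hu hu'
    have h1 := doublyReducedLaplacian_mulVec (S := S) hvw F ⟨u, hu, hu'⟩
    simp only [hFr] at h1
    rw [← hA, ← he, ← hf, hFv, hFw, hr, hAinv] at h1
    linarith
  have hLFv : (S.lapMatrix ℝ *ᵥ F) v = 1 - e ⬝ᵥ r := by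
    have h1 : (S.lapMatrix ℝ *ᵥ F) v = S.lapMatrix ℝ v v * F v + S.lapMatrix ℝ v w * F w +
        ∑ u : {u : V // u ≠ v ∧ u ≠ w}, S.lapMatrix ℝ v u.1 * F u.1 :=
      sum_eq_add_add_sum_subtype_ne hvw fun y => S.lapMatrix ℝ v y * F y
    have h2 : S.lapMatrix ℝ v v = 1 := by
      simp [SimpleGraph.lapMatrix, SimpleGraph.degMatrix, hv]
    rw [h1, h2, hFv, hFw, mul_zero, dotProduct, sub_eq_add_neg, ← Finset.sum_neg_distrib]
    simp only [mul_one, add_zero]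
    congr 1
    refine Finset.sum_congr rfl fun u _ => ?_
    rw [lapMatrix_apply_of_ne (Ne.symm u.2.1), hFr, neg_mul]
    simp only [he, nbrVec, S.adj_comm u.1 v]
  have hLFw : (S.lapMatrix ℝ *ᵥ F) w = -(f ⬝ᵥ r) := by
    have h1 : (S.lapMatrix ℝ *ᵥ F) w = S.lapMatrix ℝ w v * F v + S.lapMatrix ℝ w w * F w +
        ∑ u : {u : V // u ≠ v ∧ u ≠ w}, S.lapMatrix ℝ w u.1 * F u.1 :=
      sum_eq_add_add_sum_subtype_ne hvw fun y => S.lapMatrix ℝ w y * F y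
    have h2 : S.lapMatrix ℝ w v = 0 := by
      rw [lapMatrix_apply_of_ne hvw.symm, if_neg fun h => hadj h.symm, neg_zero]
    rw [h1, h2, hFw, zero_mul, mul_zero, zero_add, zero_add, dotProduct, ← Finset.sum_neg_distrib]
    refine Finset.sum_congr rfl fun u _ => ?_
    rw [lapMatrix_apply_of_ne (Ne.symm u.2.2), hFr, neg_mul]
    simp only [hf, nbrVec, S.adj_comm u.1 w]
  set q := f ⬝ᵥ r with hq
  have hflux : 1 - e ⬝ᵥ r = q := by
    have h1 := sum_lapMatrix_mulVec S F
    rw [sum_eq_add_add_sum_subtype_ne hvw, hLFv, hLFw,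
      Finset.sum_eq_zero fun u _ => hLF u.1 u.2.1 u.2.2] at h1
    linarith
  have hq0 : q ≠ 0 := by
    intro h0
    have h1 : S.lapMatrix ℝ *ᵥ F = 0 := by
      funext u
      by_cases hu : u = v
      · rw [hu, hLFv, hflux, h0]; rfl
      by_cases hu' : u = w
      · rw [hu', hLFw, h0, neg_zero]; rfl
      · exact hLF u hu hu'
    have h2 := eq_of_lapMatrix_mulVec_eq_zero hS.connected h1 v w
    rw [hFv, hFw] at h2
    exact one_ne_zero h2
  have hgreen : 1 + ∑ u, r u = totalGromov S w v * q := by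
    have h1 := lapMatrix_dotProduct_comm S F (totalGromov S w)
    rw [dotProduct, dotProduct, sum_eq_add_add_sum_subtype_ne hvw,
      sum_eq_add_add_sum_subtype_ne hvw, hFv, hFw, hLFv, hflux, totalGromov_root,
      lapMatrix_mulVec_totalGromov hS hvw,
      Finset.sum_eq_zero (f := fun u : {u : V // u ≠ v ∧ u ≠ w} =>
        totalGromov S w u.1 * (S.lapMatrix ℝ *ᵥ F) u.1)
        fun u _ => by rw [hLF u.1 u.2.1 u.2.2, mul_zero]] at h1
    rw [Finset.sum_congr rfl (g := r) fun u _ => by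
      rw [lapMatrix_mulVec_totalGromov hS u.2.2, mul_one, hFr]] at h1
    linarith
  have hone : ∀ y, e ⬝ᵥ (A⁻¹ *ᵥ y) + f ⬝ᵥ (A⁻¹ *ᵥ y) = ∑ u, y u := by
    intro y
    have h1 : A *ᵥ (fun _ => 1) = e + f := by
      funext u
      have h2 := doublyReducedLaplacian_mulVec (S := S) hvw (fun _ => 1) u
      rw [SimpleGraph.lapMatrix_mulVec_const_eq_zero] at h2
      rw [hA, h2]
      simp [he, hf]
    have h3 : Aᵀ = A := by
      rw [hA, doublyReducedLaplacian, Matrix.transpose_submatrix, SimpleGraph.isSymm_lapMatrix]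
    rw [← add_dotProduct, ← h1, dotProduct_comm, Matrix.dotProduct_mulVec,
      ← Matrix.mulVec_transpose, h3, hAinv]
    simp [dotProduct]
  have hnum : HasDerivAt (fun t : ℝ => 1 - t - e ⬝ᵥ ((A - t • (1 : Matrix _ _ ℝ))⁻¹ *ᵥ e))
      (-1 - e ⬝ᵥ (A⁻¹ *ᵥ r)) 0 :=
    ((hasDerivAt_id (0 : ℝ)).const_sub 1).sub (hasDerivAt_resolvent hdet e e)
  have hden := hasDerivAt_resolvent hdet f e
  have h0 : A - (0 : ℝ) • (1 : Matrix _ _ ℝ) = A := by simp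
  have hdiv := hnum.div hden (by rw [h0]; exact hq0)
  refine hdiv.congr_deriv ?_
  rw [h0, sub_zero, ← hr, hflux, ← hq, div_eq_iff (pow_ne_zero 2 hq0)]
  have h1 := hone r
  linear_combination (-q) * h1 - q * hgreen

end Derivative

end SCaterpillar

open SCaterpillar in
theorem corollary5p4 {V : Type*} [Fintype V] [DecidableEq V]
    (S : SimpleGraph V) [DecidableRel S.Adj] (hS : S.IsTree)
    (v₀ : V) (hv₀ : S.degree v₀ = 1) :
    -- existence and simplicity of the Fiedler vector, and part (a)
    (∀ (n : ℕ) (m : Fin (n + 1) → ℕ), 1 ≤ m 0 → 1 ≤ m (Fin.last n) →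
      algebraicConnectivity (caterpillar S v₀ n m) < lambdaMin (reducedLaplacian S v₀) →
      (∃ x, IsFiedlerVector (caterpillar S v₀ n m) x) ∧
      Module.finrank ℝ (Module.End.eigenspace
        (Matrix.toLin' ((caterpillar S v₀ n m).lapMatrix ℝ))
        (algebraicConnectivity (caterpillar S v₀ n m))) = 1 ∧
      ∀ x, IsFiedlerVector (caterpillar S v₀ n m) x →
        ((∀ p, MaxAt x p → InCopyAt 0 (fun u => S.degree u = 1) p) ∧
          (∀ p, MinAt x p → InCopyAt (Fin.last n) (fun u => S.degree u = 1) p)) ∨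
        ((∀ p, MinAt x p → InCopyAt 0 (fun u => S.degree u = 1) p) ∧
          (∀ p, MaxAt x p → InCopyAt (Fin.last n) (fun u => S.degree u = 1) p))) ∧
    -- the formula for the derivative in (b)
    (∀ v : V, S.degree v = 1 → 2 ≤ S.dist v₀ v → HasDerivAt (g S v v₀) (slope hS v₀ v) 0) ∧
    -- part (b)
    (∀ v : V, (∀ u : V, u ≠ v → slope hS v₀ v < slope hS v₀ u) →
      ∃ K : ℕ, ∀ (n : ℕ) (m : Fin (n + 1) → ℕ), K ≤ n → 1 ≤ m 0 → 1 ≤ m (Fin.last n) →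
        algebraicConnectivity (caterpillar S v₀ n m) < lambdaMin (reducedLaplacian S v₀) →
        ∀ x, IsFiedlerVector (caterpillar S v₀ n m) x →
          ((∀ p, MaxAt x p ↔ InCopyAt 0 (fun u => u = v) p) ∧
            (∀ p, MinAt x p ↔ InCopyAt (Fin.last n) (fun u => u = v) p)) ∨
          ((∀ p, MinAt x p ↔ InCopyAt 0 (fun u => u = v) p) ∧
            (∀ p, MaxAt x p ↔ InCopyAt (Fin.last n) (fun u => u = v) p))) := by
  obtain ⟨a, ha, -⟩ := SimpleGraph.degree_eq_one_iff_existsUnique_adj.1 hv₀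
  refine ⟨fun n m hm0 hmn hlt => ?_, fun v hv hd => ?_, fun v hv => ?_⟩
  · obtain ⟨h, hh⟩ := exists_isProfile hlt
    have hpos := pos_of_eq_algebraicConnectivity (S := S) (m := m) ha hm0 rfl
    refine ⟨exists_isFiedlerVector (exists_caterpillar_adj ha hm0),
      finrank_eigenspace_eq_one ha hm0 rfl hlt hh, fun x hx => ?_⟩
    have hpend : ∀ u, (∀ u', h u' ≤ h u) → S.degree u = 1 := fun u hu =>
      (degree_eq_one_of_isMax hS hv₀ (hh.lapMatrix_pos hS hlt hpos) hu).2
    rcases (extremal_fiedler hS ha hm0 hmn rfl hlt hh hx).1 with ⟨h1, h2⟩ | ⟨h1, h2⟩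
    · exact Or.inl ⟨fun p hp => ((h1 p).1 hp).imp fun u _ => hpend u,
        fun p hp => ((h2 p).1 hp).imp fun u _ => hpend u⟩
    · exact Or.inr ⟨fun p hp => ((h1 p).1 hp).imp fun u _ => hpend u,
        fun p hp => ((h2 p).1 hp).imp fun u _ => hpend u⟩
  · have := hasDerivAt_g (w := v₀) hS hv hd
    rwa [totalGromov_eq_neg_slope hS hv, neg_neg] at this
  · have hH : ∀ u, u ≠ v → totalGromov S v₀ u < totalGromov S v₀ v := fun u hu =>
      totalGromov_lt_of_slope_lt hS hv₀ hv hu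
    -- `μ (n - 1) ≤ 2` turns this bound on `n` into `μ H(v)² < 1`.
    obtain ⟨K, hK⟩ := exists_nat_gt (2 * totalGromov S v₀ v ^ 2 + 1)
    refine ⟨K, fun n m hKn hm0 hmn hlt x hx => ?_⟩
    obtain ⟨h, hh⟩ := exists_isProfile hlt
    have hpos := pos_of_eq_algebraicConnectivity (S := S) (m := m) ha hm0 rfl
    obtain ⟨hext, hn⟩ := extremal_fiedler hS ha hm0 hmn rfl hlt hh hx
    have hsmall : algebraicConnectivity (caterpillar S v₀ n m) * totalGromov S v₀ v ^ 2 < 1 := by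
      have h1 : (K : ℝ) ≤ n := by exact_mod_cast hKn
      nlinarith
    have hmax : (fun u => ∀ u', h u' ≤ h u) = fun u => u = v := by
      funext u
      refine propext ⟨fun hu => ?_, ?_⟩
      · by_contra hne
        exact not_lt.2 (hu v) (hh.lt_of_totalGromov_lt hS hlt hpos hH hsmall hne)
      · rintro rfl u'
        by_cases hne : u' = u
        · rw [hne]
        · exact (hh.lt_of_totalGromov_lt hS hlt hpos hH hsmall hne).le
    rwa [hmax] at hext
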